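/- **Conventions.** Let $\alpha$ be an infinite regular cardinal. A category is $\alpha$-smashing if it has coproducts of all families of fewer than $\alpha$ objects; a class of objects in it is $\alpha$-smashing if it is closed under such coproducts. In a triangulated category a class of objects is extension-closed if it contains $0$ and contains $B$ whenever there is a distinguished triangle $A\to B\to C\to A[1]$ with $A,C$ in the class. For a class $\mathcal Q$ of objects, $[\mathcal Q]^{\alpha}$ is the smallest extension-closed $\alpha$-smashing class containing $\mathcal Q$, and the $\alpha$-localizing subcategory $\langle\mathcal P\rangle^{\alpha}$ generated by $\mathcal P$ is the full triangulated subcategory with object class $[\bigcup_{i\in\mathbb Z}\mathcal P[i]]^{\alpha}$. Write $X\perp Y$ if all morphisms from objects of $X$ to objects of $Y$ are zero. A class $\mathcal P$ is $\alpha$-negative if $\mathcal P\perp[\bigcup_{i>0}\mathcal P[i]]^{\alpha}$; countably negative means $\aleph_1$-negative. A weight structure $w$ on a triangulated category $\mathcal C$ is a pair of retract-closed classes $(\mathcal C_{w\le0},\mathcal C_{w\ge0})$ with $\mathcal C_{w\le 0}\subset\mathcal C_{w\le0}[1]$, $\mathcal C_{w\ge0}[1]\subset\mathcal C_{w\ge0}$,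 $\mathcal C_{w\le0}\perp\mathcal C_{w\ge0}[1]$, and such that every object $M$ lies in a distinguished triangle $L\to M\to R\to L[1]$ with $L\in\mathcal C_{w\le0}$, $R\in\mathcal C_{w\ge0}[1]$. Its heart is $\mathcal C_{w\le0}\cap\mathcal C_{w\ge0}$. It is $\alpha$-smashing if $\mathcal C$ and $\mathcal C_{w\ge0}$ are; left non-degenerate if every object of $\bigcap_{l\in\mathbb Z}\mathcal C_{w\ge0}[l]$ is zero; generated by $\mathcal P$ if $\mathcal C_{w\ge0}=\{N:\bigcup_{i<0}\mathcal P[i]\perp N\}$; and $\alpha$-generated by $\mathcal P$ if $\mathcal C$ is $\alpha$-smashing, $\mathcal C_{w\ge0}=[\bigcup_{i\ge0}\mathcal P[i]]^{\alpha}$ and $\mathcal C_{w\le0}=[\bigcup_{i\le0}\mathcal P[i]]^{\alpha}$. An exact functor between categories with weight structures is left (right) weight-exact if it preserves the classes of objects of weight $\le0$ (resp. $\ge0$), and weight-exact if it is both. **Theorem.** Let $\alpha$ be an infinite regular cardinal. 1. Let $\alpha>\aleph_0$ and let $\mathcal P$ be an $\alpha$-negative class of objects of an $\alpha$-smashing triangulated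 category $\mathcal C'$. Then on $\mathcal C=\langle\mathcal P\rangle^{\alpha}\subset\mathcal C'$ there is an $\alpha$-smashing weight structure that is $\alpha$-generated by $\mathcal P$. 2. Conversely, if a weight structure $w$ on an $\alpha$-smashing triangulated category $\mathcal C$ is $\alpha$-generated by a class $\mathcal P$, then $\mathcal P$ is $\alpha$-negative; moreover, $w$ is left non-degenerate and generated by $\mathcal P$. 3. The heart of $w$ as in 2 is the class of all retracts in $\mathcal C$ of coproducts of families of fewer than $\alpha$ elements of $\mathcal P$. If $\alpha>\aleph_0$ and $\mathcal C=\langle\mathcal P\rangle^{\alpha}$ inside an $\alpha$-smashing triangulated category $\mathcal C'$, then $\mathcal C$ is closed under retracts in $\mathcal C'$, and the heart of a weight structure on $\mathcal C$ that is $\alpha$-generated by $\mathcal P$ is also the class of all retracts in $\mathcal C'$ of such coproducts. 4. Let $(\mathcal C,w)$ be as in 2 and let $F:\mathcal C\to\mathcal D$ be an exact functor that respects coproducts of fewer than $\alpha$ objects, where $\mathcal D$ is a triangulated category with a weight structure $v$. Then $F$ is left weight-exact if and only if $F(\mathcal P)\subset\mathcal D_{v\le0}$. If $v$ is $\alpha$-smashing,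 then $F$ is right weight-exact if and only if $F(\mathcal P)\subset\mathcal D_{v\ge0}$. 5. Let $\alpha>\aleph_0$. If $F$ as in 4 ($v$ being any weight structure) is weight-exact and every object of $\mathcal D$ is isomorphic to some $F(X)$, then $v$ is $\alpha$-generated by $F(\mathcal P)$. In particular, $w$ is the only $\alpha$-smashing weight structure on $\mathcal C$ whose heart contains $\mathcal P$. 6. Let $\alpha\ge\aleph_1$ and let $\mathcal C$ be an $\alpha$-smashing triangulated category. A class $\mathcal P$ of objects of $\mathcal C$ is $\alpha$-negative if and only if the class $\mathcal P^{<\alpha}$ of all coproducts of families of fewer than $\alpha$ elements of $\mathcal P$ is countably negative. -/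

import Mathlib

open CategoryTheory Limits Pretriangulated

universe w v u v' u'

section Smashing

variable {C : Type u} [Category.{v} C]

/-- The category has coproducts of all families of fewer than `α` objects. -/
def HasCoproductsLT (α : Cardinal.{w}) (C : Type u) [Category.{v} C] : Prop :=
  ∀ J : Type w, Cardinal.mk J < α → HasColimitsOfShape (Discrete J) C

/-- The functor respects coproducts of families of fewer than `α` objects. -/
def PreservesCoproductsLT (α : Cardinal.{w}) {D : Type u'} [Category.{v'} D] (F : C ⥤ D) : Prop :=
  ∀ J : Type w, Cardinal.mk J < α → PreservesColimitsOfShape (Discrete J) F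

/-- The class of all coproducts of families of cardinality less than `α` of objects in `P`. -/
def CategoryTheory.ObjectProperty.coproductsLT (P : ObjectProperty C) (α : Cardinal.{w}) :
    ObjectProperty C := fun Y =>
  ∃ (J : Type w) (_ : Cardinal.mk J < α) (X : J → C) (ι : ∀ j, X j ⟶ Y),
    (∀ j, P (X j)) ∧ Nonempty (IsColimit (Cofan.mk Y ι))

/-- A class of objects is `α`-smashing if it is closed under all coproducts of fewer than `α`
of its elements (the existence of these coproducts is a separate condition on the category). -/
def CategoryTheory.ObjectProperty.IsAlphaSmashing (P : ObjectProperty C) (α : Cardinal.{w}) :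
    Prop :=
  P.coproductsLT α ≤ P

end Smashing

section Triangulated

variable {C : Type u} [Category.{v} C] [HasZeroObject C] [Preadditive C] [HasShift C ℤ]
  [∀ n : ℤ, (shiftFunctor C n).Additive] [Pretriangulated C]

namespace CategoryTheory.ObjectProperty

/-- The class `P[i]`, up to isomorphism. -/
def shiftBy (P : ObjectProperty C) (i : ℤ) : ObjectProperty C := fun X =>
  ∃ M : C, P M ∧ Nonempty (X ≅ M⟦i⟧)

/-- The union of the classes `P[i]` for `i ∈ S`. -/
def shiftsIn (P : ObjectProperty C) (S : Set ℤ) : ObjectProperty C := fun X =>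
  ∃ i ∈ S, P.shiftBy i X

/-- A class of objects is extension-closed if it contains the zero object and is closed under
extensions. -/
structure IsExtensionClosed (P : ObjectProperty C) : Prop where
  zero : ∀ Z : C, IsZero Z → P Z
  ext : ∀ T ∈ distTriang C, P T.obj₁ → P T.obj₃ → P T.obj₂

/-- The smallest extension-closed `α`-smashing class containing `P`. -/
def alphaClosure (P : ObjectProperty C) (α : Cardinal.{w}) : ObjectProperty C := fun X =>
  ∀ Q : ObjectProperty C, Q.IsExtensionClosed → Q.IsAlphaSmashing α → P ≤ Q → Q X

/-- The objects of the `α`-localizing subcategory generated by `P`. -/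
def alphaLocalizing (P : ObjectProperty C) (α : Cardinal.{w}) : ObjectProperty C :=
  (P.shiftsIn Set.univ).alphaClosure α

/-- `P` is `α`-negative if there are no nonzero morphisms from `P` into the smallest
extension-closed `α`-smashing class containing `P[i]` for all `i > 0`. -/
def IsAlphaNegative (P : ObjectProperty C) (α : Cardinal.{w}) : Prop :=
  ∀ X Y : C, P X → (P.shiftsIn (Set.Ioi 0)).alphaClosure α Y → ∀ f : X ⟶ Y, f = 0

lemma le_alphaClosure (P : ObjectProperty C) (α : Cardinal.{w}) : P ≤ P.alphaClosure α :=
  fun _ hX _ _ _ h => h _ hX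

lemma alphaClosure_isExtensionClosed (P : ObjectProperty C) (α : Cardinal.{w}) :
    (P.alphaClosure α).IsExtensionClosed where
  zero Z hZ _ hQ _ _ := hQ.zero Z hZ
  ext T hT h₁ h₃ Q hQ hQ' h := hQ.ext T hT (h₁ Q hQ hQ' h) (h₃ Q hQ hQ' h)

lemma alphaClosure_isAlphaSmashing (P : ObjectProperty C) (α : Cardinal.{w}) :
    (P.alphaClosure α).IsAlphaSmashing α := by
  rintro Y ⟨J, hJ, X, ι, hX, hc⟩ Q hQ hQ' h
  exact hQ' _ ⟨J, hJ, X, ι, fun j => hX j Q hQ hQ' h, hc⟩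

instance (P : ObjectProperty C) (α : Cardinal.{w}) : (P.alphaLocalizing α).IsTriangulated where
  exists_zero := by
    obtain ⟨Z, hZ⟩ := HasZeroObject.zero (C := C)
    exact ⟨Z, hZ, (alphaClosure_isExtensionClosed _ _).zero _ hZ⟩
  isStableUnderShiftBy a := by
    refine ⟨fun X hX => ?_⟩
    refine hX (fun X => P.alphaLocalizing α (X⟦a⟧)) ⟨fun Z hZ => ?_, fun T hT h₁ h₃ => ?_⟩ ?_ ?_
    · exact (alphaClosure_isExtensionClosed _ _).zero _ ((shiftFunctor C a).map_isZero hZ)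
    · exact (alphaClosure_isExtensionClosed _ _).ext _ (Triangle.shift_distinguished T hT a) h₁ h₃
    · rintro Y ⟨J, hJ, X, ι, hX, ⟨hc⟩⟩
      exact alphaClosure_isAlphaSmashing _ _ _ ⟨J, hJ, fun j => (X j)⟦a⟧, fun j => (ι j)⟦a⟧', hX,
        ⟨isColimitCofanMkObjOfIsColimit (shiftFunctor C a) _ _ hc⟩⟩
    · rintro Y ⟨i, -, M, hM, ⟨e⟩⟩
      exact le_alphaClosure _ _ _ ⟨i + a, Set.mem_univ _, M, hM,
        ⟨(shiftFunctor C a).mapIso e ≪≫ ((shiftFunctorAdd C i a).app M).symm⟩⟩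
  ext₂' T hT h₁ h₃ :=
    le_isoClosure _ _ ((alphaClosure_isExtensionClosed _ _).ext T hT h₁ h₃)

end CategoryTheory.ObjectProperty

/-- A weight structure (homological convention): `le` is the class of objects of weight `≤ 0` and
`ge` is the class of objects of weight `≥ 0`. -/
@[ext]
structure WeightStructure (C : Type u) [Category.{v} C] [HasZeroObject C] [Preadditive C]
    [HasShift C ℤ] [∀ n : ℤ, (shiftFunctor C n).Additive] [Pretriangulated C] where
  le : ObjectProperty C
  ge : ObjectProperty C
  le_retracts : le.IsStableUnderRetracts
  ge_retracts : ge.IsStableUnderRetracts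
  le_shift : le ≤ le.shiftBy 1
  ge_shift : ge.shiftBy 1 ≤ ge
  orthogonal : ∀ X Y : C, le X → ge.shiftBy 1 Y → ∀ f : X ⟶ Y, f = 0
  decomposition : ∀ M : C, ∃ (L R : C) (f : L ⟶ M) (g : M ⟶ R) (h : R ⟶ L⟦(1 : ℤ)⟧),
    Triangle.mk f g h ∈ distTriang C ∧ le L ∧ ge.shiftBy 1 R

namespace WeightStructure

/-- The objects of the heart. -/
def heart (t : WeightStructure C) : ObjectProperty C := fun X => t.le X ∧ t.ge X

/-- Every object lying in all the classes of objects of weight `≥ l` is zero. -/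
def IsLeftNonDegenerate (t : WeightStructure C) : Prop :=
  ∀ M : C, (∀ l : ℤ, t.ge.shiftBy l M) → IsZero M

/-- The weight structure (together with the category) is `α`-smashing. -/
def IsAlphaSmashing (t : WeightStructure C) (α : Cardinal.{w}) : Prop :=
  HasCoproductsLT α C ∧ t.ge.IsAlphaSmashing α

/-- The weight structure is `α`-generated by `P`. -/
structure IsAlphaGeneratedBy (t : WeightStructure C) (α : Cardinal.{w}) (P : ObjectProperty C) :
    Prop where
  hasCoproducts : HasCoproductsLT α C
  ge_eq : t.ge = (P.shiftsIn (Set.Ici 0)).alphaClosure α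
  le_eq : t.le = (P.shiftsIn (Set.Iic 0)).alphaClosure α

/-- The weight structure is generated by `P`: an object is of weight `≥ 0` iff there are no nonzero
morphisms into it from `P[i]` for `i < 0`. -/
def IsGeneratedBy (t : WeightStructure C) (P : ObjectProperty C) : Prop :=
  ∀ Y : C, t.ge Y ↔ ∀ X : C, P.shiftsIn (Set.Iio 0) X → ∀ f : X ⟶ Y, f = 0

section

variable {D : Type u'} [Category.{v'} D] [HasZeroObject D] [Preadditive D] [HasShift D ℤ]
  [∀ n : ℤ, (shiftFunctor D n).Additive] [Pretriangulated D]

/-- `F` sends objects of weight `≤ 0` to objects of weight `≤ 0`. -/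
def IsLeftWeightExact (t : WeightStructure C) (s : WeightStructure D) (F : C ⥤ D) : Prop :=
  ∀ X : C, t.le X → s.le (F.obj X)

/-- `F` sends objects of weight `≥ 0` to objects of weight `≥ 0`. -/
def IsRightWeightExact (t : WeightStructure C) (s : WeightStructure D) (F : C ⥤ D) : Prop :=
  ∀ X : C, t.ge X → s.ge (F.obj X)

end

end WeightStructure

end Triangulated

/-! Existence: left orthogonals are closed under extensions and coproducts, so negativity of `P`
extends to orthogonality between the closures of its non-positive and its positive shifts.
Extensions of the first closure by the second form an `α`-smashing class, because coproducts of
triangles can be completed to triangles (`exists_distinguished_of_isColimit_cofan`). The class is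
also extension-closed, because extensions in the wrong order split
(`extensionProduct_isExtensionClosed`). It contains every `P[i]`, which gives weight decompositions
on the `α`-localizing subcategory. Retract-closedness is the Eilenberg swindle, and there `α > ℵ₀`
enters.

The same argument splits off the bottom cell of an object of weight `≥ 0` as a coproduct of elements
of `P`. If the object also has weight `≤ 0`, the map to the remainder vanishes, which computes the
heart. The two classes of a weight structure are each other's orthogonals up to a shift; with
generation, this yields the statements on non-degeneracy, functors and uniqueness.

Countable negativity: let `A` be the class of `α`-small coproducts from `P`. Removing bottom cells
repeatedly gives a tower of quotients `N ⟶ M n` with fibres `F n` of `n` cells. The weights of `M n`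
tend to infinity, so on maps from a fixed `A[i]` the shift of `∐ M n` is nilpotent, and `1 - shift`
is invertible on `∐ M n`. Comparison with the telescope of the constant sequence `N` presents `N` as
an extension of `∐ F n` by `(∐ F n)[1]`. Such extensions form an `α`-smashing class, so the closure
under countable coproducts is already closed under `α`-small ones. -/

set_option linter.unusedSectionVars false

/-! ### Classes of objects closed under small coproducts. -/

section Smashing

variable {C : Type u} [Category.{v} C]

/-- Colimit cofans may be reindexed along `ULift`. -/
noncomputable def CategoryTheory.Limits.isColimitCofanULift {J : Type*} {X : J → C} {Y : C}
    {ι : ∀ j, X j ⟶ Y}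
    (hc : IsColimit (Cofan.mk Y ι)) :
    IsColimit (Cofan.mk Y (fun j : ULift.{w} J => ι j.down)) :=
  Cofan.IsColimit.mk _ (fun s => Cofan.IsColimit.desc hc (fun j => s.inj ⟨j⟩))
    (fun _ j => Cofan.IsColimit.fac hc _ j.down)
    (fun s _ hm => Cofan.IsColimit.hom_ext hc _ _
      (fun j => (hm ⟨j⟩).trans (Cofan.IsColimit.fac hc (fun j => s.inj ⟨j⟩) j).symm))

lemma HasCoproductsLT.mono {α β : Cardinal.{w}} (h : HasCoproductsLT α C) (hβ : β ≤ α) :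
    HasCoproductsLT β C :=
  fun J hJ => h J (hJ.trans_le hβ)

lemma HasCoproductsLT.nat {α : Cardinal.{w}} (h : HasCoproductsLT α C)
    (hα : Cardinal.aleph0 < α) : HasColimitsOfShape (Discrete ℕ) C :=
  have := h (ULift.{w} ℕ) (by simpa using hα)
  hasColimitsOfShape_of_equivalence (Discrete.equivalence Equiv.ulift.{w, 0})

namespace CategoryTheory.ObjectProperty

variable {Q R : ObjectProperty C} {α β : Cardinal.{w}}

lemma coproductsLT_mono (h : Q ≤ R) (hβ : β ≤ α) : Q.coproductsLT β ≤ R.coproductsLT α := by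
  rintro Y ⟨J, hJ, X, ι, hX, hc⟩
  exact ⟨J, hJ.trans_le hβ, X, ι, fun j => h _ (hX j), hc⟩

lemma IsAlphaSmashing.mono (h : Q.IsAlphaSmashing α) (hβ : β ≤ α) : Q.IsAlphaSmashing β :=
  (coproductsLT_mono le_rfl hβ).trans h

lemma IsAlphaSmashing.of_isColimit_nat (h : Q.IsAlphaSmashing α) (hα : Cardinal.aleph0 < α)
    {X : ℕ → C} (hX : ∀ n, Q (X n)) {Y : C} {ι : ∀ n, X n ⟶ Y}
    (hc : IsColimit (Cofan.mk Y ι)) : Q Y :=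
  h _ ⟨ULift.{w} ℕ, by simpa using hα, fun n => X n.down, fun n => ι n.down,
    fun n => hX _, ⟨isColimitCofanULift hc⟩⟩

/-- Any object isomorphic to `X` is a coproduct of the one-element family `X`. -/
lemma IsAlphaSmashing.isClosedUnderIsomorphisms (h : Q.IsAlphaSmashing α) (hα : 1 < α) :
    Q.IsClosedUnderIsomorphisms where
  of_iso {X Y} e hX := h _ ⟨PUnit, by simpa using hα, fun _ => X, fun _ => e.hom, fun _ => hX,
    ⟨Cofan.IsColimit.mk _ (fun s => e.inv ≫ s.inj PUnit.unit) (by simp)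
      (fun s m hm => by simp [← hm PUnit.unit])⟩⟩

lemma IsAlphaSmashing.of_isZero (h : Q.IsAlphaSmashing α) (hα : 0 < α) {Z : C} (hZ : IsZero Z) :
    Q Z :=
  h _ ⟨PEmpty, by simpa using hα, PEmpty.elim, fun j => j.elim, fun j => j.elim,
    ⟨Cofan.IsColimit.mk _ (fun s => hZ.to_ _) (fun s j => j.elim) (fun s m _ => hZ.eq_of_src _ _)⟩⟩

lemma IsAlphaSmashing.biprod [Preadditive C] (h : Q.IsAlphaSmashing α)
    (hα : Cardinal.aleph0 ≤ α)
    {X Y : C} [HasBinaryBiproduct X Y] (hX : Q X) (hY : Q Y) : Q (X ⊞ Y) := by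
  refine h _ ⟨ULift.{w} Bool, (Cardinal.mk_lt_aleph0 (α := ULift.{w} Bool)).trans_le hα,
    fun b => Bool.rec X Y b.down,
    fun b => match b with
      | ⟨false⟩ => biprod.inl
      | ⟨true⟩ => biprod.inr, ?_,
    ⟨Cofan.IsColimit.mk _ (fun s => biprod.desc (s.inj ⟨false⟩) (s.inj ⟨true⟩)) ?_ ?_⟩⟩
  · rintro ⟨_ | _⟩
    exacts [hX, hY]
  · rintro s ⟨_ | _⟩
    exacts [biprod.inl_desc _ _, biprod.inr_desc _ _]
  · intro s m hm
    refine biprod.hom_ext' _ _ ?_ ?_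
    · exact (hm ⟨false⟩).trans (biprod.inl_desc _ _).symm
    · exact (hm ⟨true⟩).trans (biprod.inr_desc _ _).symm

/-- For regular `α`, the class of `α`-small coproducts of objects of `Q` is `α`-smashing. -/
lemma coproductsLT_isAlphaSmashing (Q : ObjectProperty C) (hα : α.IsRegular) :
    (Q.coproductsLT α).IsAlphaSmashing α := by
  rintro Y ⟨J, hJ, X, ι, hX, ⟨hc⟩⟩
  choose K hK X' ι' hX' hc' using hX
  refine ⟨Σ j, K j, ?_, fun p => X' p.1 p.2, fun p => ι' p.1 p.2 ≫ ι p.1, fun p => hX' _ _,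
    ⟨Cofan.isColimitTrans _ hc _ (fun j => (hc' j).some)⟩⟩
  rw [Cardinal.mk_sigma]
  exact Cardinal.sum_lt_of_isRegular hα hJ hK

lemma le_coproductsLT (Q : ObjectProperty C) (hα : 1 < α) : Q ≤ Q.coproductsLT α :=
  fun X hX => ⟨PUnit, by simpa using hα, fun _ => X, fun _ => 𝟙 X, fun _ => hX,
    ⟨Cofan.IsColimit.mk _ (fun s => s.inj PUnit.unit) (by simp)
      (fun s m hm => by simp [← hm PUnit.unit])⟩⟩

/-- A map out of a coproduct vanishes once its components do, whatever the size of the family. -/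
lemma leftOrthogonal_isAlphaSmashing [HasZeroMorphisms C] (Q : ObjectProperty C)
    (α : Cardinal.{w}) : Q.leftOrthogonal.IsAlphaSmashing α := by
  rintro Y ⟨J, hJ, X, ι, hX, ⟨hc⟩⟩ Z f hZ
  exact Cofan.IsColimit.hom_ext hc _ _
    fun j => (hX j (ι j ≫ f) hZ).trans comp_zero.symm

end CategoryTheory.ObjectProperty

end Smashing

/-! ### Split triangles and coproducts of triangles. -/

section Triangulated

variable {C : Type u} [Category.{v} C] [HasZeroObject C] [Preadditive C] [HasShift C ℤ]
  [∀ n : ℤ, (shiftFunctor C n).Additive] [Pretriangulated C]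

namespace CategoryTheory.Pretriangulated

/-- If the second morphism of a distinguished triangle vanishes, its second object is a retract of
the first one. -/
lemma nonempty_retract_of_mor₂_eq_zero {T : Triangle C} (hT : T ∈ distTriang C)
    (h : T.mor₂ = 0) : Nonempty (Retract T.obj₂ T.obj₁) := by
  obtain ⟨i, hi⟩ := T.coyoneda_exact₂ hT (𝟙 _) (by simp [h])
  exact ⟨⟨i, T.mor₁, hi.symm⟩⟩

/-- If the first morphism of a distinguished triangle vanishes, its second object is a retract of
the third one. -/
lemma nonempty_retract_of_mor₁_eq_zero {T : Triangle C} (hT : T ∈ distTriang C)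
    (h : T.mor₁ = 0) : Nonempty (Retract T.obj₂ T.obj₃) := by
  obtain ⟨r, hr⟩ := T.yoneda_exact₂ hT (𝟙 _) (by simp [h])
  exact ⟨⟨T.mor₂, r, hr.symm⟩⟩

/-- A split short exact sequence gives a distinguished triangle. -/
lemma distinguished_of_split {A B X : C} {f : A ⟶ B} {g : B ⟶ X} {s : X ⟶ B} {r : B ⟶ A}
    (hr : f ≫ r = 𝟙 A) (hs : s ≫ g = 𝟙 X) (h : r ≫ f + g ≫ s = 𝟙 B) :
    Triangle.mk f g (0 : X ⟶ A⟦(1 : ℤ)⟧) ∈ distTriang C := by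
  -- The two remaining biproduct identities follow from the three assumed ones.
  have hfg : f ≫ g = 0 := by
    have h₁ : f ≫ g ≫ s = 0 := by
      have := f ≫= h
      rw [Preadditive.comp_add, reassoc_of% hr, Category.comp_id] at this
      simpa using this
    have h₂ := h₁ =≫ g
    simpa [hs] using h₂
  have hsr : s ≫ r = 0 := by
    have h₁ : (s ≫ r) ≫ f = 0 := by
      have := s ≫= h
      rw [Preadditive.comp_add, reassoc_of% hs, Category.comp_id] at this
      simpa using this
    have h₂ := h₁ =≫ r
    simpa [hr] using h₂
  let e : B ≅ A ⊞ X :=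
    { hom := biprod.lift r g
      inv := biprod.desc f s
      hom_inv_id := by simpa using h
      inv_hom_id := by ext <;> simp [hr, hs, hfg, hsr] }
  refine isomorphic_distinguished _ (binaryBiproductTriangle_distinguished A X) _
    (Triangle.isoMk _ _ (Iso.refl _) e (Iso.refl _) ?_ ?_ ?_)
  · change f ≫ biprod.lift r g = 𝟙 A ≫ biprod.inl
    ext <;> simp [hr, hfg]
  · change g ≫ 𝟙 X = biprod.lift r g ≫ biprod.snd
    simp
  · exact zero_comp.trans comp_zero.symm

/-- A morphism between coproducts of the first two terms of distinguished triangles extends to a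
distinguished triangle whose third object is a coproduct of the third objects. -/
lemma exists_distinguished_of_isColimit_cofan {J : Type*} {X₁ X₂ X₃ : J → C}
    {f : ∀ j, X₁ j ⟶ X₂ j} {g : ∀ j, X₂ j ⟶ X₃ j} {h : ∀ j, X₃ j ⟶ (X₁ j)⟦(1 : ℤ)⟧}
    (hT : ∀ j, Triangle.mk (f j) (g j) (h j) ∈ distTriang C)
    {Y₁ Y₂ : C} {ι₁ : ∀ j, X₁ j ⟶ Y₁} (h₁ : IsColimit (Cofan.mk Y₁ ι₁))
    {ι₂ : ∀ j, X₂ j ⟶ Y₂} (h₂ : IsColimit (Cofan.mk Y₂ ι₂)) :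
    ∃ (Y₃ : C) (f' : Y₁ ⟶ Y₂) (g' : Y₂ ⟶ Y₃) (h' : Y₃ ⟶ Y₁⟦(1 : ℤ)⟧) (ι₃ : ∀ j, X₃ j ⟶ Y₃),
      Triangle.mk f' g' h' ∈ distTriang C ∧ (∀ j, g j ≫ ι₃ j = ι₂ j ≫ g') ∧
      Nonempty (IsColimit (Cofan.mk Y₃ ι₃)) := by
  let f' : Y₁ ⟶ Y₂ := Cofan.IsColimit.desc h₁ (fun j => f j ≫ ι₂ j)
  have hf' (j) : ι₁ j ≫ f' = f j ≫ ι₂ j := Cofan.IsColimit.fac h₁ _ j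
  -- `Y₃` is defined as a cone; that it is a coproduct of the `X₃ j` is then checked by a five-lemma
  -- argument on maps into each `W`.
  obtain ⟨Y₃, g', h', hT'⟩ := distinguished_cocone_triangle f'
  have key (j) : ∃ ι₃ : X₃ j ⟶ Y₃, g j ≫ ι₃ = ι₂ j ≫ g' ∧ h j ≫ (ι₁ j)⟦(1 : ℤ)⟧' = ι₃ ≫ h' :=
    complete_distinguished_triangle_morphism _ _ (hT j) hT' (ι₁ j) (ι₂ j) (hf' j).symm
  choose ι₃ hg hh using key
  have h₁' := isColimitCofanMkObjOfIsColimit (shiftFunctor C (1 : ℤ)) _ _ h₁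
  have h₂' := isColimitCofanMkObjOfIsColimit (shiftFunctor C (1 : ℤ)) _ _ h₂
  -- Uniqueness: `m` factors through `h'`, and the factor extends along the shift of `f'` because it
  -- does so on each summand; consecutive maps of the triangle compose to zero.
  have hzero (W : C) (m : Y₃ ⟶ W) (hm : ∀ j, ι₃ j ≫ m = 0) : m = 0 := by
    obtain ⟨k, rfl⟩ : ∃ k : Y₁⟦(1 : ℤ)⟧ ⟶ W, m = h' ≫ k :=
      Triangle.yoneda_exact₃ _ hT' m (Cofan.IsColimit.hom_ext h₂ _ _ (fun j => by
        change ι₂ j ≫ g' ≫ m = ι₂ j ≫ 0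
        rw [← reassoc_of% hg j, hm, comp_zero, comp_zero]))
    have key (j) : ∃ l : (X₂ j)⟦(1 : ℤ)⟧ ⟶ W,
        (ι₁ j)⟦(1 : ℤ)⟧' ≫ k = -((f j)⟦(1 : ℤ)⟧' ≫ l) := by
      obtain ⟨l, hl⟩ := Triangle.yoneda_exact₃ _ (rot_of_distTriang _ (hT j))
        ((ι₁ j)⟦(1 : ℤ)⟧' ≫ k) (by
          change h j ≫ (ι₁ j)⟦(1 : ℤ)⟧' ≫ k = 0
          rw [reassoc_of% hh j, hm])
      exact ⟨l, hl.trans (Preadditive.neg_comp _ _)⟩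
    choose l hl using key
    have hk : k = -(f'⟦(1 : ℤ)⟧' ≫ Cofan.IsColimit.desc h₂' l) :=
      Cofan.IsColimit.hom_ext h₁' _ _ (fun j => by
        change (ι₁ j)⟦(1 : ℤ)⟧' ≫ k = (ι₁ j)⟦(1 : ℤ)⟧' ≫ (-(f'⟦(1 : ℤ)⟧' ≫ _))
        rw [hl, Preadditive.comp_neg, ← Functor.map_comp_assoc, hf', Functor.map_comp,
          Category.assoc]
        exact congr_arg (fun t => -((f j)⟦(1 : ℤ)⟧' ≫ t))
          (Cofan.IsColimit.fac h₂' l j).symm)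
    have h₃ : h' ≫ f'⟦(1 : ℤ)⟧' = 0 := comp_distTriang_mor_zero₃₁ _ hT'
    rw [hk, Preadditive.comp_neg, reassoc_of% h₃, zero_comp, neg_zero]
  -- Existence: a first candidate `m` is correct after precomposition with each `g j`; the error
  -- factors through `h j` and is corrected by a map out of the shift of `Y₁`.
  have hdesc (W : C) (φ : ∀ j, X₃ j ⟶ W) : ∃ m : Y₃ ⟶ W, ∀ j, ι₃ j ≫ m = φ j := by
    obtain ⟨m, hm⟩ : ∃ m : Y₃ ⟶ W, Cofan.IsColimit.desc h₂ (fun j => g j ≫ φ j) = g' ≫ m :=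
      Triangle.yoneda_exact₂ _ hT' _ (Cofan.IsColimit.hom_ext h₁ _ _ (fun j => by
        change ι₁ j ≫ f' ≫ _ = ι₁ j ≫ 0
        have hfac : ι₂ j ≫ Cofan.IsColimit.desc h₂ (fun j => g j ≫ φ j) = g j ≫ φ j :=
          Cofan.IsColimit.fac h₂ _ j
        have hfg : f j ≫ g j = 0 := comp_distTriang_mor_zero₁₂ _ (hT j)
        rw [reassoc_of% hf' j, hfac, reassoc_of% hfg, zero_comp, comp_zero]))
    have key (j) : ∃ k : (X₁ j)⟦(1 : ℤ)⟧ ⟶ W, ι₃ j ≫ m - φ j = h j ≫ k :=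
      Triangle.yoneda_exact₃ _ (hT j) (ι₃ j ≫ m - φ j) (by
        change g j ≫ (ι₃ j ≫ m - φ j) = 0
        rw [Preadditive.comp_sub, reassoc_of% hg j, ← hm, sub_eq_zero]
        exact Cofan.IsColimit.fac h₂ _ j)
    choose k hk using key
    refine ⟨m - h' ≫ Cofan.IsColimit.desc h₁' k, fun j => ?_⟩
    have hfac : (ι₁ j)⟦(1 : ℤ)⟧' ≫ Cofan.IsColimit.desc h₁' k = k j :=
      Cofan.IsColimit.fac h₁' _ j
    rw [Preadditive.comp_sub, ← reassoc_of% hh j, hfac, ← hk, sub_sub_cancel]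
  choose desc hdesc using hdesc
  refine ⟨Y₃, f', g', h', ι₃, hT', hg,
    ⟨Cofan.IsColimit.mk _ (fun s => desc _ s.inj) (fun s j => hdesc _ _ _) (fun s m hm => ?_)⟩⟩
  refine sub_eq_zero.mp (hzero _ _ fun j => ?_)
  rw [Preadditive.comp_sub, hdesc, sub_eq_zero]
  exact hm j

end CategoryTheory.Pretriangulated

end Triangulated

/-! ### Closures under shifts, extensions and retracts. -/

section Triangulated

open scoped ZeroObject

variable {C : Type u} [Category.{v} C] [HasZeroObject C] [Preadditive C] [HasShift C ℤ]
  [∀ n : ℤ, (shiftFunctor C n).Additive] [Pretriangulated C]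

namespace CategoryTheory.ObjectProperty

variable {P Q R : ObjectProperty C} {α : Cardinal.{w}}

/-- An isomorphism is the first map of a distinguished triangle with zero third object. -/
lemma IsExtensionClosed.isClosedUnderIsomorphisms (hQ : Q.IsExtensionClosed) :
    Q.IsClosedUnderIsomorphisms where
  of_iso {X Y} e hX :=
    hQ.ext (Triangle.mk e.hom (0 : Y ⟶ 0) 0)
      (isomorphic_distinguished _ (contractible_distinguished X) _
        (Triangle.isoMk _ _ (Iso.refl _) e.symm (Iso.refl _)
          (e.hom_inv_id.trans (Category.id_comp _).symm)
          ((isZero_zero C).eq_of_tgt _ _) ((isZero_zero C).eq_of_src _ _)))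
      hX (hQ.zero _ (isZero_zero C))

lemma IsExtensionClosed.containsZero (hQ : Q.IsExtensionClosed) : Q.ContainsZero where
  exists_zero := ⟨0, isZero_zero C, hQ.zero _ (isZero_zero C)⟩

lemma IsExtensionClosed.extensionProduct_le (hQ : Q.IsExtensionClosed) {P₁ P₂ : ObjectProperty C}
    (h₁ : P₁ ≤ Q) (h₂ : P₂ ≤ Q) : extensionProduct P₁ P₂ ≤ Q := by
  rintro X ⟨Y, Z, f, g, h, hT, hY, hZ⟩
  exact hQ.ext _ hT (h₁ _ hY) (h₂ _ hZ)

lemma isExtensionClosed_of_isTriangulatedClosed₂ [Q.IsTriangulatedClosed₂]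
    [Q.IsClosedUnderIsomorphisms] [Q.ContainsZero] : Q.IsExtensionClosed where
  zero _ hZ := Q.prop_of_isZero hZ
  ext T hT h₁ h₃ := Q.ext_of_isTriangulatedClosed₂ T hT h₁ h₃

lemma leftOrthogonal_isExtensionClosed (Q : ObjectProperty C) :
    Q.leftOrthogonal.IsExtensionClosed :=
  isExtensionClosed_of_isTriangulatedClosed₂

lemma rightOrthogonal_isExtensionClosed (Q : ObjectProperty C) :
    Q.rightOrthogonal.IsExtensionClosed :=
  isExtensionClosed_of_isTriangulatedClosed₂

lemma alphaClosure_le (hQ : Q.IsExtensionClosed) (hQ' : Q.IsAlphaSmashing α) (h : P ≤ Q) :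
    P.alphaClosure α ≤ Q :=
  fun _ hX => hX Q hQ hQ' h

lemma alphaClosure_mono (α : Cardinal.{w}) (h : P ≤ Q) : P.alphaClosure α ≤ Q.alphaClosure α :=
  alphaClosure_le (alphaClosure_isExtensionClosed _ _) (alphaClosure_isAlphaSmashing _ _)
    (h.trans (le_alphaClosure _ _))

instance (P : ObjectProperty C) (α : Cardinal.{w}) :
    (P.alphaClosure α).IsClosedUnderIsomorphisms :=
  (alphaClosure_isExtensionClosed P α).isClosedUnderIsomorphisms

/-! ### Shifts -/

lemma shiftBy_obj (i : ℤ) {X : C} (hX : P X) : P.shiftBy i (X⟦i⟧) :=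
  ⟨X, hX, ⟨Iso.refl _⟩⟩

lemma shiftBy_iff [Q.IsClosedUnderIsomorphisms] {i j : ℤ} (hij : i + j = 0) (X : C) :
    Q.shiftBy i X ↔ Q (X⟦j⟧) := by
  constructor
  · rintro ⟨M, hM, ⟨e⟩⟩
    exact Q.prop_of_iso (((shiftFunctorCompIsoId C i j hij).app M).symm ≪≫
      (shiftFunctor C j).mapIso e.symm) hM
  · intro h
    exact ⟨_, h, ⟨((shiftFunctorCompIsoId C j i (by omega)).app X).symm⟩⟩

instance (P : ObjectProperty C) (i : ℤ) : (P.shiftBy i).IsClosedUnderIsomorphisms where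
  of_iso e := by
    rintro ⟨M, hM, ⟨e'⟩⟩
    exact ⟨M, hM, ⟨e.symm ≪≫ e'⟩⟩

lemma shiftBy_mono (h : P ≤ Q) (i : ℤ) : P.shiftBy i ≤ Q.shiftBy i := by
  rintro X ⟨M, hM, he⟩
  exact ⟨M, h _ hM, he⟩

lemma le_shiftBy_zero (P : ObjectProperty C) : P ≤ P.shiftBy 0 :=
  fun X hX => ⟨X, hX, ⟨((shiftFunctorZero C ℤ).app X).symm⟩⟩

lemma shiftBy_shift {i j k : ℤ} (h : i + j = k) {X : C} (hX : P.shiftBy i X) :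
    P.shiftBy k (X⟦j⟧) := by
  obtain ⟨M, hM, ⟨e⟩⟩ := hX
  exact ⟨M, hM, ⟨(shiftFunctor C j).mapIso e ≪≫ ((shiftFunctorAdd' C i j k h).app M).symm⟩⟩

lemma le_shiftsIn (P : ObjectProperty C) {S : Set ℤ} (hS : 0 ∈ S) : P ≤ P.shiftsIn S :=
  fun _ hX => ⟨0, hS, P.le_shiftBy_zero _ hX⟩

lemma shiftsIn_mono (h : P ≤ Q) {S T : Set ℤ} (hST : S ⊆ T) : P.shiftsIn S ≤ Q.shiftsIn T := by
  rintro X ⟨i, hi, hX⟩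
  exact ⟨i, hST hi, shiftBy_mono h i _ hX⟩

lemma shiftBy_isExtensionClosed (hQ : Q.IsExtensionClosed) (i : ℤ) :
    (Q.shiftBy i).IsExtensionClosed := by
  have := hQ.isClosedUnderIsomorphisms
  constructor
  · intro Z hZ
    rw [shiftBy_iff (add_neg_cancel i)]
    exact hQ.zero _ ((shiftFunctor C _).map_isZero hZ)
  · intro T hT h₁ h₃
    rw [shiftBy_iff (add_neg_cancel i)] at h₁ h₃ ⊢
    exact hQ.ext _ (Triangle.shift_distinguished T hT (-i)) h₁ h₃

lemma shiftBy_isAlphaSmashing [Q.IsClosedUnderIsomorphisms] (hQ : Q.IsAlphaSmashing α) (i : ℤ) :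
    (Q.shiftBy i).IsAlphaSmashing α := by
  rintro Y ⟨J, hJ, X, ι, hX, ⟨hc⟩⟩
  rw [shiftBy_iff (add_neg_cancel i)]
  exact hQ _ ⟨J, hJ, fun j => (X j)⟦-i⟧, fun j => (ι j)⟦-i⟧',
    fun j => (shiftBy_iff (add_neg_cancel i) _).mp (hX j),
    ⟨isColimitCofanMkObjOfIsColimit (shiftFunctor C (-i)) _ _ hc⟩⟩

/-- Shifting an object of the class generated by `P[s]`, `s ∈ S`. -/
lemma alphaClosure_shift {S T : Set ℤ} {i : ℤ} (hST : ∀ s ∈ S, s + i ∈ T) {X : C}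
    (hX : (P.shiftsIn S).alphaClosure α X) : (P.shiftsIn T).alphaClosure α (X⟦i⟧) := by
  have : (P.shiftsIn S).alphaClosure α ≤ ((P.shiftsIn T).alphaClosure α).shiftBy (-i) := by
    refine alphaClosure_le (shiftBy_isExtensionClosed (alphaClosure_isExtensionClosed _ _) _)
      (shiftBy_isAlphaSmashing (alphaClosure_isAlphaSmashing _ _) _) ?_
    rintro Y ⟨s, hs, hY⟩
    rw [shiftBy_iff (neg_add_cancel i)]
    exact le_alphaClosure _ _ _ ⟨s + i, hST s hs, shiftBy_shift rfl hY⟩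
  exact (shiftBy_iff (neg_add_cancel i) X).mp (this _ hX)

lemma alphaClosure_shiftBy {S T : Set ℤ} (i : ℤ) (hST : ∀ s, s ∈ S ↔ s + i ∈ T) :
    ((P.shiftsIn S).alphaClosure α).shiftBy i = (P.shiftsIn T).alphaClosure α := by
  ext X
  constructor
  · rintro ⟨M, hM, ⟨e⟩⟩
    exact prop_of_iso _ e.symm (alphaClosure_shift (fun s hs => (hST s).mp hs) hM)
  · intro hX
    rw [shiftBy_iff (add_neg_cancel i)]
    exact alphaClosure_shift (fun s hs => (hST _).mpr (by simpa using hs)) hX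

/-! ### Extension products -/

lemma extensionProduct_isAlphaSmashing (hC : HasCoproductsLT α C) (hQ : Q.IsAlphaSmashing α)
    (hR : R.IsAlphaSmashing α) : (extensionProduct Q R).IsAlphaSmashing α := by
  rintro Y ⟨J, hJ, X, ι, hX, ⟨hc⟩⟩
  choose X₁ X₃ f g h hT h₁ h₃ using hX
  have := hC J hJ
  obtain ⟨Y₃, f', g', h', ι₃, hT', -, hc'⟩ := exists_distinguished_of_isColimit_cofan hT
    (coproductIsCoproduct X₁) hc
  exact ⟨_, _, f', g', h', hT', hQ _ ⟨J, hJ, X₁, _, h₁, ⟨coproductIsCoproduct X₁⟩⟩,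
    hR _ ⟨J, hJ, X₃, ι₃, h₃, hc'⟩⟩

/-- An extension of objects without nonzero morphisms of degree one splits. -/
lemma exists_iso_biprod_of_extensionProduct (h : ∀ X Y, Q X → R Y → ∀ f : X ⟶ Y⟦(1 : ℤ)⟧, f = 0)
    {X : C} (hX : extensionProduct R Q X) :
    ∃ Y Z : C, R Y ∧ Q Z ∧ Nonempty (X ≅ Y ⊞ Z) := by
  obtain ⟨Y, Z, f, g, k, hT, hY, hZ⟩ := hX
  obtain ⟨e, -⟩ := exists_iso_binaryBiproduct_of_distTriang _ hT (h _ _ hZ hY k)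
  exact ⟨Y, Z, hY, hZ, ⟨e⟩⟩

/-- A split extension can be read in either order. -/
lemma extensionProduct_swap_le (h : ∀ X Y, Q X → R Y → ∀ f : X ⟶ Y⟦(1 : ℤ)⟧, f = 0) :
    extensionProduct R Q ≤ extensionProduct Q R := by
  intro X hX
  obtain ⟨Y, Z, hY, hZ, ⟨e⟩⟩ := exists_iso_biprod_of_extensionProduct h hX
  exact prop_of_iso _ ((biprod.braiding Z Y) ≪≫ e.symm)
    ⟨Z, Y, _, _, _, binaryBiproductTriangle_distinguished Z Y, hZ, hY⟩

/-- In the fourfold product `Q * R * Q * R`, the inner `R * Q` can be swapped to `Q * R`;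
associativity then collects `(Q * Q) * (R * R)`, which both closure hypotheses reduce to `Q * R`. -/
lemma extensionProduct_isExtensionClosed [IsTriangulated C] (hQ : Q.IsExtensionClosed)
    (hR : R.IsExtensionClosed) (h : ∀ X Y, Q X → R Y → ∀ f : X ⟶ Y⟦(1 : ℤ)⟧, f = 0) :
    (extensionProduct Q R).IsExtensionClosed where
  zero Z hZ := by
    have := hR.containsZero
    exact le_extensionProduct_left R _ (hQ.zero Z hZ)
  ext T hT h₁ h₃ := by
    have key : extensionProduct (extensionProduct Q R) (extensionProduct Q R) ≤
        extensionProduct Q R := by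
      rw [extensionProduct_assoc, ← extensionProduct_assoc R Q R]
      refine (monotone_extensionProduct_right _
        (monotone_extensionProduct_left _ (extensionProduct_swap_le h))).trans ?_
      rw [extensionProduct_assoc, ← extensionProduct_assoc Q Q]
      exact (monotone_extensionProduct_left _ (hQ.extensionProduct_le le_rfl le_rfl)).trans
        (monotone_extensionProduct_right _ (hR.extensionProduct_le le_rfl le_rfl))
    exact key _ ⟨_, _, T.mor₁, T.mor₂, T.mor₃, hT, h₁, h₃⟩

/-! ### Retracts -/

/-- The Eilenberg swindle: if `X` is a retract of `M`, then the coproduct of countably many copies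
of `M` splits as the direct sum of itself and `X`. -/
lemma exists_split_of_retract [HasColimitsOfShape (Discrete ℕ) C] {X M : C}
    (ρ : Retract X M) :
    ∃ (f r : (∐ fun _ : ℕ => M) ⟶ ∐ fun _ : ℕ => M) (g : (∐ fun _ : ℕ => M) ⟶ X)
      (s : X ⟶ ∐ fun _ : ℕ => M), f ≫ r = 𝟙 _ ∧ s ≫ g = 𝟙 _ ∧ r ≫ f + g ≫ s = 𝟙 _ := by
  let e : M ⟶ M := ρ.r ≫ ρ.i
  have he : e ≫ e = e := by simp [e]
  let ι (n : ℕ) : M ⟶ ∐ fun _ : ℕ => M := Limits.Sigma.ι (fun _ : ℕ => M) n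
  -- `f` fixes the `(1 - e)`-part of each copy and moves the `e`-part one copy up. `r` moves it back
  -- down and kills the `e`-part of copy `0`, which is the summand `X` seen by `g`.
  let f : (∐ fun _ : ℕ => M) ⟶ ∐ fun _ : ℕ => M :=
    Limits.Sigma.desc fun n => (𝟙 M - e) ≫ ι n + e ≫ ι (n + 1)
  let r : (∐ fun _ : ℕ => M) ⟶ ∐ fun _ : ℕ => M :=
    Limits.Sigma.desc fun n =>
      Nat.casesOn n ((𝟙 M - e) ≫ ι 0) fun n => e ≫ ι n + (𝟙 M - e) ≫ ι (n + 1)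
  let g : (∐ fun _ : ℕ => M) ⟶ X := Limits.Sigma.desc fun n => Nat.casesOn n ρ.r fun _ => 0
  have hf (n) : ι n ≫ f = (𝟙 M - e) ≫ ι n + e ≫ ι (n + 1) := Limits.Sigma.ι_desc _ _
  have hr₀ : ι 0 ≫ r = (𝟙 M - e) ≫ ι 0 := Limits.Sigma.ι_desc _ _
  have hr (n) : ι (n + 1) ≫ r = e ≫ ι n + (𝟙 M - e) ≫ ι (n + 1) := Limits.Sigma.ι_desc _ _
  have hg₀ : ι 0 ≫ g = ρ.r := Limits.Sigma.ι_desc _ _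
  have hg (n) : ι (n + 1) ≫ g = 0 := Limits.Sigma.ι_desc _ _
  refine ⟨f, r, g, ρ.i ≫ ι 0, ?_, ?_, ?_⟩
  · refine Limits.Sigma.hom_ext _ _ fun n => ?_
    change ι n ≫ f ≫ r = ι n ≫ 𝟙 _
    rw [reassoc_of% hf, Preadditive.add_comp, Category.assoc, Category.assoc, hr]
    cases n <;> simp [hr₀, hr, Preadditive.sub_comp, Preadditive.comp_sub, reassoc_of% he]
  · simp [hg₀]
  · refine Limits.Sigma.hom_ext _ _ fun n => ?_
    change ι n ≫ (r ≫ f + g ≫ ρ.i ≫ ι 0) = ι n ≫ 𝟙 _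
    rw [Preadditive.comp_add]
    cases n
    · rw [reassoc_of% hr₀, reassoc_of% hg₀, hf]
      simp [Preadditive.sub_comp, Preadditive.comp_sub, e]
    · rw [reassoc_of% hr, reassoc_of% hg]
      simp [Preadditive.sub_comp, Preadditive.comp_sub, reassoc_of% he, hf]

/-- With `M'` the countable coproduct of copies of `M`, rotating the split triangle `M' ⟶ M' ⟶ X`
makes `X` an extension of `M'` by `M'[1]`. The version below for the shift by `-1` uses the
complementary splitting `X ⟶ M' ⟶ M'`. -/
lemma isStableUnderRetracts_of_shift_one (hC : HasCoproductsLT α C) (hα : Cardinal.aleph0 < α)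
    (hQ : Q.IsExtensionClosed) (hQ' : Q.IsAlphaSmashing α) (h : ∀ X, Q X → Q (X⟦(1 : ℤ)⟧)) :
    Q.IsStableUnderRetracts where
  of_retract {X M} ρ hM := by
    have := hC.nat hα
    obtain ⟨f, r, g, s, hfr, hsg, hid⟩ := exists_split_of_retract ρ
    have hM' : Q (∐ fun _ : ℕ => M) :=
      hQ'.of_isColimit_nat hα (fun _ => hM) (coproductIsCoproduct _)
    exact hQ.ext _ (rot_of_distTriang _ (distinguished_of_split hfr hsg hid)) hM' (h _ hM')

lemma isStableUnderRetracts_of_shift_neg_one (hC : HasCoproductsLT α C)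
    (hα : Cardinal.aleph0 < α)
    (hQ : Q.IsExtensionClosed) (hQ' : Q.IsAlphaSmashing α) (h : ∀ X, Q X → Q (X⟦(-1 : ℤ)⟧)) :
    Q.IsStableUnderRetracts where
  of_retract {X M} ρ hM := by
    have := hC.nat hα
    obtain ⟨f, r, g, s, hfr, hsg, hid⟩ := exists_split_of_retract ρ
    have hM' : Q (∐ fun _ : ℕ => M) :=
      hQ'.of_isColimit_nat hα (fun _ => hM) (coproductIsCoproduct _)
    exact hQ.ext _ (inv_rot_of_distTriang _ (distinguished_of_split hsg hfr
      ((add_comm _ _).trans hid))) (h _ hM') hM'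

end CategoryTheory.ObjectProperty

end Triangulated

/-! ### Negative classes and the weight structures they generate. -/

section Triangulated

open scoped ZeroObject

variable {C : Type u} [Category.{v} C] [HasZeroObject C] [Preadditive C] [HasShift C ℤ]
  [∀ n : ℤ, (shiftFunctor C n).Additive] [Pretriangulated C]

namespace CategoryTheory.ObjectProperty

variable {P Q : ObjectProperty C} {α : Cardinal.{w}}

/-! ### Negative classes -/

/-- Shifting orthogonality to the objects generated by positive shifts of `P`. -/
lemma eq_zero_of_shiftBy
    (hQ : ∀ X Y, Q X → (P.shiftsIn (Set.Ioi 0)).alphaClosure α Y → ∀ f : X ⟶ Y, f = 0)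
    {i : ℤ} {S : Set ℤ} (hS : ∀ s ∈ S, i < s) {X Y : C} (hX : Q.shiftBy i X)
    (hY : (P.shiftsIn S).alphaClosure α Y) (f : X ⟶ Y) : f = 0 := by
  obtain ⟨M, hM, ⟨e⟩⟩ := hX
  have hg : ((shiftFunctorCompIsoId C i (-i) (add_neg_cancel i)).app M).inv ≫
      (e.inv ≫ f)⟦-i⟧' = 0 :=
    hQ _ _ hM (alphaClosure_shift (fun s hs => by have := hS s hs; simp; omega) hY) _
  rw [Preadditive.IsIso.comp_left_eq_zero] at hg
  have hf : e.inv ≫ f = 0 := (shiftFunctor C (-i)).map_injective (by rw [hg, Functor.map_zero])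
  rwa [Preadditive.IsIso.comp_left_eq_zero] at hf

lemma IsAlphaNegative.coproductsLT (hP : P.IsAlphaNegative α) :
    ∀ X Y, P.coproductsLT α X → (P.shiftsIn (Set.Ioi 0)).alphaClosure α Y →
      ∀ f : X ⟶ Y, f = 0 := by
  intro X Y hX hY f
  have h : P ≤ ((P.shiftsIn (Set.Ioi 0)).alphaClosure α).leftOrthogonal :=
    fun X hX Y f hY => hP X Y hX hY f
  exact (coproductsLT_mono h le_rfl).trans (leftOrthogonal_isAlphaSmashing _ α) _ hX f hY

lemma coproductsLT_le_alphaClosure (P : ObjectProperty C) (α : Cardinal.{w}) {S : Set ℤ}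
    (hS : 0 ∈ S) : P.coproductsLT α ≤ (P.shiftsIn S).alphaClosure α :=
  (coproductsLT_mono ((le_shiftsIn P hS).trans (le_alphaClosure _ _)) le_rfl).trans
    (alphaClosure_isAlphaSmashing _ _)

/-- There are no nonzero degree-one maps between such coproducts, so every extension is a biproduct.
-/
lemma IsAlphaNegative.coproductsLT_isExtensionClosed (hP : P.IsAlphaNegative α)
    (hα : α.IsRegular) : (P.coproductsLT α).IsExtensionClosed where
  zero Z hZ := (coproductsLT_isAlphaSmashing P hα).of_isZero hα.pos hZ
  ext T hT h₁ h₃ := by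
    have hs := coproductsLT_isAlphaSmashing P hα
    have := hs.isClosedUnderIsomorphisms (Cardinal.one_lt_aleph0.trans_le hα.1)
    obtain ⟨Y, Z, hY, hZ, ⟨e⟩⟩ := exists_iso_biprod_of_extensionProduct
      (Q := P.coproductsLT α) (R := P.coproductsLT α) (fun X Y hX hY f =>
        hP.coproductsLT _ _ hX (alphaClosure_shift (S := {0}) (by simp)
          (coproductsLT_le_alphaClosure P α (by simp) _ hY)) f)
      ⟨_, _, T.mor₁, T.mor₂, T.mor₃, hT, h₁, h₃⟩
    exact prop_of_iso _ e.symm (hs.biprod hα.1 hY hZ)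

/-- The bottom cell of an object generated by the `P[i]`, `i ≥ k`. -/
lemma IsAlphaNegative.alphaClosure_le_extensionProduct [IsTriangulated C]
    (hC : HasCoproductsLT α C) (hα : α.IsRegular) (hP : P.IsAlphaNegative α) (k : ℤ) :
    (P.shiftsIn (Set.Ici k)).alphaClosure α ≤
      extensionProduct ((P.coproductsLT α).shiftBy k)
        ((P.shiftsIn (Set.Ici (k + 1))).alphaClosure α) := by
  have hs := coproductsLT_isAlphaSmashing P hα
  have := hs.isClosedUnderIsomorphisms (Cardinal.one_lt_aleph0.trans_le hα.1)
  have hA := shiftBy_isExtensionClosed (hP.coproductsLT_isExtensionClosed hα) k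
  have hG := alphaClosure_isExtensionClosed (P.shiftsIn (Set.Ici (k + 1))) α
  have := hA.containsZero
  have := hG.containsZero
  refine alphaClosure_le (extensionProduct_isExtensionClosed hA hG fun X Y hX hY f => ?_)
    (extensionProduct_isAlphaSmashing hC (shiftBy_isAlphaSmashing hs k)
      (alphaClosure_isAlphaSmashing _ _)) ?_
  -- The vanishing concerns maps into `Y[1]`, so the bound `k + 1` for `Y` becomes `k + 2`.
  · exact eq_zero_of_shiftBy hP.coproductsLT (S := Set.Ici (k + 2)) (by simp; omega) hX
      (alphaClosure_shift (by simp; omega) hY) f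
  · rintro X ⟨i, hi, hX⟩
    obtain rfl | h : i = k ∨ k + 1 ≤ i := by simp at hi; omega
    · exact le_extensionProduct_left _ _
        (shiftBy_mono (le_coproductsLT P (Cardinal.one_lt_aleph0.trans_le hα.1)) _ _ hX)
    · exact le_extensionProduct_right _ _ (le_alphaClosure _ _ _ ⟨i, h, hX⟩)

lemma IsAlphaNegative.orthogonal (hP : P.IsAlphaNegative α) {X Y : C}
    (hX : (P.shiftsIn (Set.Iic 0)).alphaClosure α X)
    (hY : (P.shiftsIn (Set.Ioi 0)).alphaClosure α Y) (f : X ⟶ Y) : f = 0 := by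
  refine alphaClosure_le (leftOrthogonal_isExtensionClosed _)
    (leftOrthogonal_isAlphaSmashing _ _) ?_ _ hX f hY
  rintro X ⟨i, hi, hX⟩ Y f hY
  exact eq_zero_of_shiftBy hP (fun s hs => lt_of_le_of_lt hi hs) hX hY f

/-- Weight decompositions: each `P[i]` lies in one factor according to the sign of `i`, and
orthogonality makes the product extension-closed. -/
lemma IsAlphaNegative.alphaLocalizing_le [IsTriangulated C] (hC : HasCoproductsLT α C)
    (hP : P.IsAlphaNegative α) :
    P.alphaLocalizing α ≤ extensionProduct ((P.shiftsIn (Set.Iic 0)).alphaClosure α)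
      ((P.shiftsIn (Set.Ioi 0)).alphaClosure α) := by
  have hA := alphaClosure_isExtensionClosed (P.shiftsIn (Set.Iic 0)) α
  have hG := alphaClosure_isExtensionClosed (P.shiftsIn (Set.Ioi 0)) α
  have := hA.containsZero
  have := hG.containsZero
  refine alphaClosure_le (extensionProduct_isExtensionClosed hA hG fun X Y hX hY f => ?_)
    (extensionProduct_isAlphaSmashing hC (alphaClosure_isAlphaSmashing _ _)
      (alphaClosure_isAlphaSmashing _ _)) ?_
  · exact hP.orthogonal hX (alphaClosure_shift (by simp; omega) hY) f
  · rintro X ⟨i, -, hX⟩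
    obtain h | h := le_or_gt i 0
    · exact le_extensionProduct_left _ _ (le_alphaClosure _ _ _ ⟨i, h, hX⟩)
    · exact le_extensionProduct_right _ _ (le_alphaClosure _ _ _ ⟨i, h, hX⟩)

lemma alphaClosure_shiftBy_Ici (P : ObjectProperty C) (α : Cardinal.{w}) (i : ℤ) :
    ((P.shiftsIn (Set.Ici 0)).alphaClosure α).shiftBy i =
      (P.shiftsIn (Set.Ici i)).alphaClosure α :=
  alphaClosure_shiftBy i (by simp)

lemma alphaClosure_shiftBy_Iic (P : ObjectProperty C) (α : Cardinal.{w}) (i : ℤ) :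
    ((P.shiftsIn (Set.Iic 0)).alphaClosure α).shiftBy i =
      (P.shiftsIn (Set.Iic i)).alphaClosure α :=
  alphaClosure_shiftBy i (by simp)

/-- The weight structure `α`-generated by an `α`-negative class whose `α`-localizing
subcategory is the whole category. -/
def IsAlphaNegative.weightStructure [IsTriangulated C] (hC : HasCoproductsLT α C)
    (hα : Cardinal.aleph0 < α) (hP : P.IsAlphaNegative α)
    (htop : ∀ X, P.alphaLocalizing α X) : WeightStructure C where
  le := (P.shiftsIn (Set.Iic 0)).alphaClosure α
  ge := (P.shiftsIn (Set.Ici 0)).alphaClosure α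
  le_retracts := isStableUnderRetracts_of_shift_neg_one hC hα (alphaClosure_isExtensionClosed _ _)
    (alphaClosure_isAlphaSmashing _ _) fun _ hX => alphaClosure_shift (by simp; omega) hX
  ge_retracts := isStableUnderRetracts_of_shift_one hC hα (alphaClosure_isExtensionClosed _ _)
    (alphaClosure_isAlphaSmashing _ _) fun _ hX => alphaClosure_shift (by simp; omega) hX
  le_shift := by
    rw [alphaClosure_shiftBy_Iic]
    exact alphaClosure_mono _ (shiftsIn_mono le_rfl (by simp))
  ge_shift := by
    rw [alphaClosure_shiftBy_Ici]
    exact alphaClosure_mono _ (shiftsIn_mono le_rfl (by simp))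
  orthogonal X Y hX hY f := by
    rw [alphaClosure_shiftBy_Ici] at hY
    exact hP.orthogonal hX hY f
  decomposition M := by
    rw [alphaClosure_shiftBy_Ici]
    exact hP.alphaLocalizing_le hC M (htop M)

lemma IsAlphaNegative.isAlphaGeneratedBy_weightStructure [IsTriangulated C]
    (hC : HasCoproductsLT α C) (hα : Cardinal.aleph0 < α) (hP : P.IsAlphaNegative α)
    (htop : ∀ X, P.alphaLocalizing α X) :
    (hP.weightStructure hC hα htop).IsAlphaGeneratedBy α P where
  hasCoproducts := hC
  ge_eq := rfl
  le_eq := rfl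

end CategoryTheory.ObjectProperty

end Triangulated

/-! ### Orthogonality in weight structures, weight-exact functors, uniqueness. -/

section Triangulated

open scoped ZeroObject

variable {C : Type u} [Category.{v} C] [HasZeroObject C] [Preadditive C] [HasShift C ℤ]
  [∀ n : ℤ, (shiftFunctor C n).Additive] [Pretriangulated C]
  {D : Type u'} [Category.{v'} D] [HasZeroObject D] [Preadditive D] [HasShift D ℤ]
  [∀ n : ℤ, (shiftFunctor D n).Additive] [Pretriangulated D]

namespace CategoryTheory.ObjectProperty

variable {P : ObjectProperty C} {Q : ObjectProperty D} {α : Cardinal.{w}}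

lemma shiftBy_obj_of_commShift (F : C ⥤ D) [F.CommShift ℤ] (h : ∀ X, P X → Q (F.obj X)) {i : ℤ}
    {X : C} (hX : P.shiftBy i X) : Q.shiftBy i (F.obj X) := by
  obtain ⟨M, hM, ⟨e⟩⟩ := hX
  exact ⟨_, h _ hM, ⟨F.mapIso e ≪≫ (F.commShiftIso i).app M⟩⟩

lemma shiftsIn_obj_of_commShift (F : C ⥤ D) [F.CommShift ℤ] (h : ∀ X, P X → Q (F.obj X))
    {S : Set ℤ} {X : C} (hX : P.shiftsIn S X) : Q.shiftsIn S (F.obj X) := by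
  obtain ⟨i, hi, hX⟩ := hX
  exact ⟨i, hi, shiftBy_obj_of_commShift F h hX⟩

lemma obj_of_alphaClosure (F : C ⥤ D) [F.CommShift ℤ] [F.IsTriangulated]
    (hF : PreservesCoproductsLT α F) (hQ : Q.IsExtensionClosed) (hQ' : Q.IsAlphaSmashing α)
    (h : ∀ X, P X → Q (F.obj X)) {X : C} (hX : P.alphaClosure α X) : Q (F.obj X) := by
  refine alphaClosure_le (Q := Q.inverseImage F) ⟨fun Z hZ => ?_, fun T hT h₁ h₃ => ?_⟩ ?_ h _ hX
  · exact hQ.zero _ (F.map_isZero hZ)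
  · exact hQ.ext _ (F.map_distinguished T hT) h₁ h₃
  · rintro Y ⟨J, hJ, X, ι, hX, ⟨hc⟩⟩
    have := hF J hJ
    exact hQ' _ ⟨J, hJ, fun j => F.obj (X j), fun j => F.map (ι j), hX,
      ⟨isColimitCofanMkObjOfIsColimit F _ _ hc⟩⟩

end CategoryTheory.ObjectProperty

namespace WeightStructure

open ObjectProperty

variable (t : WeightStructure C) (s : WeightStructure D) {P : ObjectProperty C} {α : Cardinal.{w}}

instance : t.le.IsStableUnderRetracts := t.le_retracts

instance : t.ge.IsStableUnderRetracts := t.ge_retracts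

/-- The decomposition of `M[1]`, shifted back; in this form the right-hand term can be compared with
`t.ge` itself. -/
lemma exists_distinguished (M : C) : ∃ (L R : C) (f : L ⟶ M) (g : M ⟶ R) (h : R ⟶ L⟦(1 : ℤ)⟧),
    Triangle.mk f g h ∈ distTriang C ∧ t.le.shiftBy (-1) L ∧ t.ge R := by
  obtain ⟨L, R, f, g, h, hT, hL, hR⟩ := t.decomposition (M⟦(1 : ℤ)⟧)
  have key : extensionProduct (t.le.shiftBy (-1)) t.ge ((M⟦(1 : ℤ)⟧)⟦(-1 : ℤ)⟧) :=
    ⟨_, _, _, _, _, Triangle.shift_distinguished _ hT (-1), shiftBy_obj _ hL,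
      (shiftBy_iff (by simp) _).mp hR⟩
  exact prop_of_iso (extensionProduct (t.le.shiftBy (-1)) t.ge)
    ((shiftFunctorCompIsoId C (1 : ℤ) (-1) (by simp)).app M) key

lemma orthogonal_shift_neg_one {X Y : C} (hX : t.le.shiftBy (-1) X) (hY : t.ge Y) (f : X ⟶ Y) :
    f = 0 := by
  refine (shiftFunctor C (1 : ℤ)).map_injective ?_
  rw [Functor.map_zero]
  exact t.orthogonal _ _ ((shiftBy_iff (by simp) _).mp hX) (shiftBy_obj _ hY) _

/-- If `X` is left orthogonal, the map `X ⟶ R` of its decomposition vanishes, so `X` is a retract of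
`L`. -/
lemma le_eq_leftOrthogonal : t.le = (t.ge.shiftBy 1).leftOrthogonal := by
  refine le_antisymm (fun X hX Y f hY => t.orthogonal X Y hX hY f) fun X hX => ?_
  obtain ⟨L, R, f, g, h, hT, hL, hR⟩ := t.decomposition X
  obtain ⟨ρ⟩ := nonempty_retract_of_mor₂_eq_zero hT (hX g hR)
  exact prop_of_retract _ ρ hL

lemma ge_eq_rightOrthogonal : t.ge = (t.le.shiftBy (-1)).rightOrthogonal := by
  refine le_antisymm (fun Y hY X f hX => t.orthogonal_shift_neg_one hX hY f) fun X hX => ?_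
  obtain ⟨L, R, f, g, h, hT, hL, hR⟩ := t.exists_distinguished X
  obtain ⟨ρ⟩ := nonempty_retract_of_mor₁_eq_zero hT (hX f hL)
  exact prop_of_retract _ ρ hR

lemma le_isExtensionClosed : t.le.IsExtensionClosed := by
  rw [le_eq_leftOrthogonal]
  exact leftOrthogonal_isExtensionClosed _

lemma le_isAlphaSmashing (α : Cardinal.{w}) : t.le.IsAlphaSmashing α := by
  rw [le_eq_leftOrthogonal]
  exact leftOrthogonal_isAlphaSmashing _ α

lemma ge_isExtensionClosed : t.ge.IsExtensionClosed := by
  rw [ge_eq_rightOrthogonal]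
  exact rightOrthogonal_isExtensionClosed _

lemma le_of_shiftBy {i : ℤ} (hi : i ≤ 0) : t.le.shiftBy i ≤ t.le := by
  obtain ⟨n, rfl⟩ : ∃ n : ℕ, i = -n := ⟨i.natAbs, by omega⟩
  clear hi
  induction n with
  | zero =>
    rintro X ⟨M, hM, ⟨e⟩⟩
    exact prop_of_iso _ (e ≪≫ (shiftFunctorZero' C _ (by simp)).app M).symm hM
  | succ n ih =>
    rintro X ⟨M, hM, ⟨e⟩⟩
    refine ih _ ⟨M⟦(-1 : ℤ)⟧, (shiftBy_iff (by simp) _).mp (t.le_shift _ hM),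
      ⟨e ≪≫ (shiftFunctorAdd' C (-1 : ℤ) (-n) _ (by push_cast; ring)).app M⟩⟩

lemma ge_of_shiftBy {i : ℤ} (hi : 0 ≤ i) : t.ge.shiftBy i ≤ t.ge := by
  obtain ⟨n, rfl⟩ := Int.eq_ofNat_of_zero_le hi
  clear hi
  induction n with
  | zero =>
    rintro X ⟨M, hM, ⟨e⟩⟩
    exact prop_of_iso _ (e ≪≫ (shiftFunctorZero' C _ (by simp)).app M).symm hM
  | succ n ih =>
    rintro X ⟨M, hM, ⟨e⟩⟩
    refine ih _ ⟨M⟦(1 : ℤ)⟧, t.ge_shift _ (shiftBy_obj _ hM),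
      ⟨e ≪≫ (shiftFunctorAdd' C (1 : ℤ) n _ (by push_cast; ring)).app M⟩⟩

section Functor

variable {t s} (F : C ⥤ D) [F.CommShift ℤ] [F.IsTriangulated]

/-- The decomposition is taken in the source: its image under `F` has vanishing second map by
orthogonality in `D`. -/
lemma IsRightWeightExact.exists_retract_of_le (hF : t.IsRightWeightExact s F) {X : C}
    (hX : s.le (F.obj X)) : ∃ L, t.le L ∧ Nonempty (Retract (F.obj X) (F.obj L)) := by
  obtain ⟨L, R, f, g, h, hT, hL, hR⟩ := t.decomposition X
  exact ⟨L, hL, nonempty_retract_of_mor₂_eq_zero (F.map_distinguished _ hT)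
    (s.orthogonal _ _ hX (shiftBy_obj_of_commShift F hF hR) _)⟩

lemma IsLeftWeightExact.exists_retract_of_ge (hF : t.IsLeftWeightExact s F) {X : C}
    (hX : s.ge (F.obj X)) : ∃ R, t.ge R ∧ Nonempty (Retract (F.obj X) (F.obj R)) := by
  obtain ⟨L, R, f, g, h, hT, hL, hR⟩ := t.exists_distinguished X
  exact ⟨R, hR, nonempty_retract_of_mor₁_eq_zero (F.map_distinguished _ hT)
    (s.orthogonal_shift_neg_one (shiftBy_obj_of_commShift F hF hL) hX _)⟩

end Functor

/-- Weight structures are determined by inclusions of both classes. -/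
lemma eq_of_le {t t' : WeightStructure C} (h : t.le ≤ t'.le) (h' : t.ge ≤ t'.ge) : t' = t := by
  refine WeightStructure.ext (le_antisymm ?_ h) (le_antisymm ?_ h')
  · rw [le_eq_leftOrthogonal, le_eq_leftOrthogonal]
    exact fun X hX Y f hY => hX f (shiftBy_mono h' _ _ hY)
  · rw [ge_eq_rightOrthogonal, ge_eq_rightOrthogonal]
    exact fun X hX Y f hY => hX f (shiftBy_mono h _ _ hY)

namespace IsAlphaGeneratedBy

variable {t} (ht : t.IsAlphaGeneratedBy α P)
include ht

lemma le_le : P ≤ t.le := by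
  rw [ht.le_eq]
  exact (le_shiftsIn P (by simp)).trans (le_alphaClosure _ _)

lemma le_ge : P ≤ t.ge := by
  rw [ht.ge_eq]
  exact (le_shiftsIn P (by simp)).trans (le_alphaClosure _ _)

lemma shiftBy_ge_eq (i : ℤ) : t.ge.shiftBy i = (P.shiftsIn (Set.Ici i)).alphaClosure α := by
  rw [ht.ge_eq, alphaClosure_shiftBy_Ici]

lemma shiftBy_le_eq (i : ℤ) : t.le.shiftBy i = (P.shiftsIn (Set.Iic i)).alphaClosure α := by
  rw [ht.le_eq, alphaClosure_shiftBy_Iic]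

lemma isAlphaSmashing : t.IsAlphaSmashing α := by
  refine ⟨ht.hasCoproducts, ?_⟩
  rw [ht.ge_eq]
  exact alphaClosure_isAlphaSmashing _ _

lemma isAlphaNegative : P.IsAlphaNegative α := fun X Y hX hY f =>
  t.orthogonal X Y (ht.le_le _ hX) (by rw [ht.shiftBy_ge_eq]; exact hY) f

lemma alphaLocalizing (X : C) : P.alphaLocalizing α X := by
  obtain ⟨L, R, f, g, h, hT, hL, hR⟩ := t.decomposition X
  rw [ht.le_eq] at hL
  rw [ht.shiftBy_ge_eq] at hR
  exact (alphaClosure_isExtensionClosed _ _).ext _ hT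
    (alphaClosure_mono _ (shiftsIn_mono le_rfl (by simp)) _ hL)
    (alphaClosure_mono _ (shiftsIn_mono le_rfl (by simp)) _ hR)

/-- The objects without nonzero maps to `M` contain every `P[i]`, since `M` has weight `≥ i + 1`.
They therefore contain everything generated, including `M` itself. -/
lemma isLeftNonDegenerate : t.IsLeftNonDegenerate := by
  intro M hM
  have : P.alphaLocalizing α ≤ leftOrthogonal (fun Y => Y = M) := by
    refine alphaClosure_le (leftOrthogonal_isExtensionClosed _)
      (leftOrthogonal_isAlphaSmashing _ _) ?_
    rintro X ⟨i, -, hX⟩ _ f rfl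
    have hY := hM (i + 1)
    rw [ht.shiftBy_ge_eq] at hY
    exact eq_zero_of_shiftBy ht.isAlphaNegative (by simp) hX hY f
  rw [IsZero.iff_id_eq_zero]
  exact this M (ht.alphaLocalizing M) (𝟙 M) rfl

lemma isGeneratedBy : t.IsGeneratedBy P := by
  intro Y
  constructor
  · rintro hY X ⟨i, hi, hX⟩ f
    rw [ht.ge_eq] at hY
    exact eq_zero_of_shiftBy ht.isAlphaNegative (fun s hs => lt_of_lt_of_le hi hs) hX hY f
  · intro hY
    rw [ge_eq_rightOrthogonal, ht.shiftBy_le_eq]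
    have : (P.shiftsIn (Set.Iic (-1))).alphaClosure α ≤ leftOrthogonal (fun Z => Z = Y) := by
      refine alphaClosure_le (leftOrthogonal_isExtensionClosed _)
        (leftOrthogonal_isAlphaSmashing _ _) ?_
      rintro X hX _ f rfl
      exact hY X (shiftsIn_mono le_rfl (by intro i; simp; omega) _ hX) f
    exact fun X f hX => this X hX f rfl

/-- Splitting off the bottom cell leaves a remainder of weight `≥ 1`, to which an object of weight
`≤ 0` maps trivially; the object is thus a retract of its bottom cell. -/
lemma heart_eq [IsTriangulated C] (hα : α.IsRegular) :
    t.heart = (P.coproductsLT α).retractClosure := by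
  refine le_antisymm ?_ ?_
  · rintro X ⟨hX, hX'⟩
    rw [ht.ge_eq] at hX'
    obtain ⟨A, R, f, g, h, hT, hA, hR⟩ :=
      ht.isAlphaNegative.alphaClosure_le_extensionProduct ht.hasCoproducts hα 0 _ hX'
    rw [zero_add, ← ht.shiftBy_ge_eq] at hR
    obtain ⟨A', hA', ⟨e⟩⟩ := hA
    obtain ⟨ρ⟩ := nonempty_retract_of_mor₂_eq_zero hT (t.orthogonal _ _ hX hR _)
    exact ⟨A', hA', ⟨ρ.trans (Retract.ofIso (e ≪≫ (shiftFunctorZero C ℤ).app A'))⟩⟩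
  · rintro X ⟨Y, hY, ⟨ρ⟩⟩
    exact ⟨prop_of_retract _ ρ
        ((coproductsLT_mono ht.le_le le_rfl).trans (t.le_isAlphaSmashing α) _ hY),
      prop_of_retract _ ρ ((coproductsLT_mono ht.le_ge le_rfl).trans ht.isAlphaSmashing.2 _ hY)⟩

section Functor

variable {s} {F : C ⥤ D} [F.CommShift ℤ] [F.IsTriangulated] (hF : PreservesCoproductsLT α F)
include hF

lemma isLeftWeightExact_iff : t.IsLeftWeightExact s F ↔ ∀ X : C, P X → s.le (F.obj X) := by
  refine ⟨fun h X hX => h _ (ht.le_le _ hX), fun h X hX => ?_⟩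
  rw [ht.le_eq] at hX
  refine obj_of_alphaClosure F hF s.le_isExtensionClosed (s.le_isAlphaSmashing α) ?_ hX
  rintro X ⟨i, hi, hX⟩
  exact s.le_of_shiftBy hi _ (shiftBy_obj_of_commShift F h hX)

lemma isRightWeightExact_iff (hs : s.IsAlphaSmashing α) :
    t.IsRightWeightExact s F ↔ ∀ X : C, P X → s.ge (F.obj X) := by
  refine ⟨fun h X hX => h _ (ht.le_ge _ hX), fun h X hX => ?_⟩
  rw [ht.ge_eq] at hX
  refine obj_of_alphaClosure F hF s.ge_isExtensionClosed hs.2 ?_ hX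
  rintro X ⟨i, hi, hX⟩
  exact s.ge_of_shiftBy hi _ (shiftBy_obj_of_commShift F h hX)

lemma hasCoproductsLT_of_essSurj [F.EssSurj] : HasCoproductsLT α D := by
  intro J hJ
  have := ht.hasCoproducts J hJ
  have := hF J hJ
  refine ⟨fun K => ?_⟩
  let X (j : J) : C := F.objPreimage (K.obj ⟨j⟩)
  have : HasCoproduct fun j => F.obj (X j) :=
    ⟨⟨⟨_, isColimitCofanMkObjOfIsColimit F _ _ (coproductIsCoproduct X)⟩⟩⟩
  exact hasColimit_of_iso (F := Discrete.functor fun j => F.obj (X j))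
    (Discrete.natIso fun j => (F.objObjPreimageIso (K.obj j)).symm)

/-- The class of objects of weight `≥ 0` in the target is `α`-smashing. -/
lemma ge_isAlphaSmashing_of_essSurj [F.EssSurj] (hl : t.IsLeftWeightExact s F)
    (hr : t.IsRightWeightExact s F) : s.ge.IsAlphaSmashing α := by
  rintro Y ⟨J, hJ, Z, ι, hZ, ⟨hc⟩⟩
  -- Each `Z j` is a retract of some `F (R j)` with `R j` in `t.ge`; hence `Y` is a retract of `F (∐
  -- R)`.
  have hR (j) : ∃ R, t.ge R ∧ Nonempty (Retract (Z j) (F.obj R)) := by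
    obtain ⟨R, hR, ⟨ρ⟩⟩ := hl.exists_retract_of_ge F (X := F.objPreimage (Z j))
      (prop_of_iso _ (F.objObjPreimageIso (Z j)).symm (hZ j))
    exact ⟨R, hR, ⟨(Retract.ofIso (F.objObjPreimageIso (Z j)).symm).trans ρ⟩⟩
  choose R hR ρ using hR
  have := ht.hasCoproducts J hJ
  have := hF J hJ
  have hc' := isColimitCofanMkObjOfIsColimit F _ _ (coproductIsCoproduct R)
  have hge : s.ge (F.obj (∐ R)) :=
    hr _ (ht.isAlphaSmashing.2 _ ⟨J, hJ, R, _, hR, ⟨coproductIsCoproduct R⟩⟩)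
  refine prop_of_retract _ (Retract.mk
    (Cofan.IsColimit.desc hc fun j => (ρ j).some.i ≫ F.map (Limits.Sigma.ι R j))
    (Cofan.IsColimit.desc hc' fun j => (ρ j).some.r ≫ ι j) ?_) hge
  refine Cofan.IsColimit.hom_ext hc _ _ fun j => ?_
  rw [Cofan.IsColimit.fac_assoc, Category.assoc]
  erw [Cofan.IsColimit.fac hc' _ j]
  simp

/-- Objects of either class of `s` are retracts of images of objects of the matching class of `t`.
Those images lie in the required closure, which the swindle in `D` shows to be retract-closed. -/
lemma isAlphaGeneratedBy_map_of_essSurj (hα : Cardinal.aleph0 < α) [F.EssSurj]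
    (hl : t.IsLeftWeightExact s F) (hr : t.IsRightWeightExact s F) :
    s.IsAlphaGeneratedBy α (P.map F) := by
  have hD := ht.hasCoproductsLT_of_essSurj hF
  have hP (X : C) (hX : P X) : P.map F (F.obj X) := P.prop_map_obj F hX
  have hle : P.map F ≤ s.le := by
    rintro _ ⟨X, hX, ⟨e⟩⟩
    exact prop_of_iso _ e (hl _ (ht.le_le _ hX))
  have hge : P.map F ≤ s.ge := by
    rintro _ ⟨X, hX, ⟨e⟩⟩
    exact prop_of_iso _ e (hr _ (ht.le_ge _ hX))
  refine ⟨hD, le_antisymm (fun Y hY => ?_) ?_, le_antisymm (fun Y hY => ?_) ?_⟩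
  · obtain ⟨R, hR, ⟨ρ⟩⟩ := hl.exists_retract_of_ge F (X := F.objPreimage Y)
      (prop_of_iso _ (F.objObjPreimageIso Y).symm hY)
    rw [ht.ge_eq] at hR
    have : ((P.map F).shiftsIn (Set.Ici 0)).alphaClosure α (F.obj R) :=
      obj_of_alphaClosure F hF (alphaClosure_isExtensionClosed _ _)
        (alphaClosure_isAlphaSmashing _ _)
        (fun X hX => le_alphaClosure _ _ _ (shiftsIn_obj_of_commShift F hP hX)) hR
    have := isStableUnderRetracts_of_shift_one hD hα
      (alphaClosure_isExtensionClosed ((P.map F).shiftsIn (Set.Ici 0)) α)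
      (alphaClosure_isAlphaSmashing _ _) fun _ hX => alphaClosure_shift (by simp; omega) hX
    exact prop_of_retract _ ((Retract.ofIso (F.objObjPreimageIso Y).symm).trans ρ) ‹_›
  · refine alphaClosure_le s.ge_isExtensionClosed
      (ht.ge_isAlphaSmashing_of_essSurj hF hl hr) ?_
    rintro X ⟨i, hi, hX⟩
    exact s.ge_of_shiftBy hi _ (shiftBy_mono hge _ _ hX)
  · obtain ⟨L, hL, ⟨ρ⟩⟩ := hr.exists_retract_of_le F (X := F.objPreimage Y)
      (prop_of_iso _ (F.objObjPreimageIso Y).symm hY)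
    rw [ht.le_eq] at hL
    have : ((P.map F).shiftsIn (Set.Iic 0)).alphaClosure α (F.obj L) :=
      obj_of_alphaClosure F hF (alphaClosure_isExtensionClosed _ _)
        (alphaClosure_isAlphaSmashing _ _)
        (fun X hX => le_alphaClosure _ _ _ (shiftsIn_obj_of_commShift F hP hX)) hL
    have := isStableUnderRetracts_of_shift_neg_one hD hα
      (alphaClosure_isExtensionClosed ((P.map F).shiftsIn (Set.Iic 0)) α)
      (alphaClosure_isAlphaSmashing _ _) fun _ hX => alphaClosure_shift (by simp; omega) hX
    exact prop_of_retract _ ((Retract.ofIso (F.objObjPreimageIso Y).symm).trans ρ) ‹_›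
  · refine alphaClosure_le s.le_isExtensionClosed (s.le_isAlphaSmashing α) ?_
    rintro X ⟨i, hi, hX⟩
    exact s.le_of_shiftBy hi _ (shiftBy_mono hle _ _ hX)

end Functor

/-- Generation puts both classes of `t` inside those of `t'`; orthogonality reverses the inclusions.
-/
lemma eq_iff (t' : WeightStructure C) :
    (t'.IsAlphaSmashing α ∧ P ≤ t'.heart) ↔ t' = t := by
  constructor
  · rintro ⟨hs, hP⟩
    refine eq_of_le ?_ ?_
    · rw [ht.le_eq]
      refine alphaClosure_le t'.le_isExtensionClosed (t'.le_isAlphaSmashing α) ?_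
      rintro X ⟨i, hi, hX⟩
      exact t'.le_of_shiftBy hi _ (shiftBy_mono (fun X hX => (hP X hX).1) _ _ hX)
    · rw [ht.ge_eq]
      refine alphaClosure_le t'.ge_isExtensionClosed hs.2 ?_
      rintro X ⟨i, hi, hX⟩
      exact t'.ge_of_shiftBy hi _ (shiftBy_mono (fun X hX => (hP X hX).2) _ _ hX)
  · rintro rfl
    exact ⟨ht.isAlphaSmashing, fun X hX => ⟨ht.le_le _ hX, ht.le_ge _ hX⟩⟩

end IsAlphaGeneratedBy

end WeightStructure

end Triangulated

/-! ### Cell towers, telescopes and the reduction to countable negativity. -/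

section Triangulated

open scoped ZeroObject

variable {C : Type u} [Category.{v} C] [HasZeroObject C] [Preadditive C] [HasShift C ℤ]
  [∀ n : ℤ, (shiftFunctor C n).Additive] [Pretriangulated C]

namespace CategoryTheory.ObjectProperty

/-- The objects obtained by `n` successive extensions by objects of `A[k]`, …, `A[k + n - 1]`. -/
def cells (A : ObjectProperty C) (k : ℤ) : ℕ → ObjectProperty C
  | 0 => fun X => IsZero X
  | n + 1 => extensionProduct (A.cells k n) (A.shiftBy (k + n))

/-- The countable coproducts of objects with finitely many cells. -/
def countableCells (A : ObjectProperty C) (k : ℤ) : ObjectProperty C := fun Y =>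
  ∃ (F : ℕ → C) (ι : ∀ n, F n ⟶ Y), (∀ n, A.cells k n (F n)) ∧
    Nonempty (IsColimit (Cofan.mk Y ι))

variable {A : ObjectProperty C} {α β : Cardinal.{w}}

lemma cells_isAlphaSmashing [A.IsClosedUnderIsomorphisms] (hC : HasCoproductsLT α C)
    (hA : A.IsAlphaSmashing α) (k : ℤ) (n : ℕ) : (A.cells k n).IsAlphaSmashing α := by
  induction n with
  | zero =>
    rintro Y ⟨J, hJ, X, ι, hX, ⟨hc⟩⟩
    refine (IsZero.iff_id_eq_zero Y).mpr ?_
    exact Cofan.IsColimit.hom_ext hc _ _ fun j => (hX j).eq_of_src _ _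
  | succ n ih => exact extensionProduct_isAlphaSmashing hC ih (shiftBy_isAlphaSmashing hA _)

lemma cells_le_alphaClosure (A : ObjectProperty C) (β : Cardinal.{w}) (k : ℤ) (n : ℕ) :
    A.cells k n ≤ (A.shiftsIn (Set.Ici k)).alphaClosure β := by
  induction n with
  | zero => exact fun X hX => (alphaClosure_isExtensionClosed _ _).zero X hX
  | succ n ih =>
    exact (alphaClosure_isExtensionClosed _ _).extensionProduct_le ih
      fun X hX => le_alphaClosure _ _ _ ⟨k + n, by simp, hX⟩

/-- The two coproducts are interchanged. Since the `n`-th summand is filtered by `n` cells for every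
`j`, the coproduct over `j` stays in `A.cells k n`. -/
lemma countableCells_isAlphaSmashing [A.IsClosedUnderIsomorphisms] (hC : HasCoproductsLT α C)
    (hA : A.IsAlphaSmashing α) (k : ℤ) : (A.countableCells k).IsAlphaSmashing α := by
  rintro Y ⟨J, hJ, X, ι, hX, ⟨hc⟩⟩
  choose F i hF hi using hX
  have := hC J hJ
  refine ⟨fun n => ∐ fun j => F j n, fun n => Limits.Sigma.desc fun j => i j n ≫ ι j, fun n =>
    cells_isAlphaSmashing hC hA k n _ ⟨J, hJ, _, _, fun j => hF j n, ⟨coproductIsCoproduct _⟩⟩,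
    ⟨Cofan.IsColimit.mk _ (fun s => Cofan.IsColimit.desc hc fun j =>
      Cofan.IsColimit.desc (hi j).some fun n =>
        Limits.Sigma.ι (fun j => F j n) j ≫ s.inj n) ?_ ?_⟩⟩
  · intro s n
    refine Limits.Sigma.hom_ext _ _ fun j => ?_
    simp only [Cofan.mk_pt, cofan_mk_inj, Sigma.ι_desc_assoc, Category.assoc]
    erw [Cofan.IsColimit.fac hc, Cofan.IsColimit.fac (hi j).some]
  · intro s m hm
    refine Cofan.IsColimit.hom_ext hc _ _ fun j => ?_
    rw [Cofan.IsColimit.fac hc]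
    refine Cofan.IsColimit.hom_ext (hi j).some _ _ fun n => ?_
    rw [Cofan.IsColimit.fac (hi j).some, ← hm n]
    simp

lemma countableCells_le_alphaClosure (A : ObjectProperty C) (hβ : Cardinal.aleph0 < β) (k : ℤ) :
    A.countableCells k ≤ (A.shiftsIn (Set.Ici k)).alphaClosure β := by
  rintro Y ⟨F, ι, hF, ⟨hc⟩⟩
  exact (alphaClosure_isAlphaSmashing _ _).of_isColimit_nat hβ
    (fun n => cells_le_alphaClosure A β k n _ (hF n)) hc

/-- Each object generated by the `A[i]`, `i ≥ k`, has a tower of quotients by cells. -/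
lemma IsAlphaNegative.exists_tower [IsTriangulated C] (hC : HasCoproductsLT β C)
    (hβ : β.IsRegular) (hA : A.IsAlphaNegative β) (hA' : A.IsAlphaSmashing β) (k : ℤ) {N : C}
    (hN : (A.shiftsIn (Set.Ici k)).alphaClosure β N) :
    ∃ (M : ℕ → C) (q : ∀ n, M n ⟶ M (n + 1)) (p : ∀ n, N ⟶ M n),
      (∀ n : ℕ, (A.shiftsIn (Set.Ici (k + n))).alphaClosure β (M n)) ∧
      (∀ n, p n ≫ q n = p (n + 1)) ∧
      ∀ n, ∃ (F : C) (f : F ⟶ N) (h : M n ⟶ F⟦(1 : ℤ)⟧),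
        Triangle.mk f (p n) h ∈ distTriang C ∧ A.cells k n F := by
  let S (n : ℕ) := { x : Σ M : C, N ⟶ M // (A.shiftsIn (Set.Ici (k + n))).alphaClosure β x.1 ∧
    ∃ (F : C) (f : F ⟶ N) (h : x.1 ⟶ F⟦(1 : ℤ)⟧),
      Triangle.mk f x.2 h ∈ distTriang C ∧ A.cells k n F }
  have step (n : ℕ) (x : S n) : ∃ (y : S (n + 1)) (q : x.1.1 ⟶ y.1.1), x.1.2 ≫ q = y.1.2 := by
    obtain ⟨⟨M, p⟩, hM, F, f, h, hT, hF⟩ := x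
    obtain ⟨a, M', f', q, h', hT', ha, hM'⟩ :=
      hA.alphaClosure_le_extensionProduct hC hβ _ _ hM
    obtain ⟨F', f'', h'', hT''⟩ := distinguished_cocone_triangle₁ (p ≫ q)
    -- The fibre of `p ≫ q` is an extension of the fibre `F` of `p` by the fibre `a` of `q`, that
    -- is, `F` with one more cell attached.
    have o := Triangulated.someOctahedron' rfl hT hT' hT''
    refine ⟨⟨⟨M', p ≫ q⟩, by simpa [add_assoc] using hM', F', f'', h'', hT'', F, a, _, _, _,
      o.mem, hF, shiftBy_mono hA' _ _ ha⟩, q, rfl⟩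
  choose next q hq using step
  let x₀ : S 0 := ⟨⟨N, 𝟙 N⟩, by simpa using hN, 0, 0, 0,
    contractible_distinguished₁ N, isZero_zero C⟩
  let x (n : ℕ) : S n := Nat.rec (motive := S) x₀ (fun n y => next n y) n
  exact ⟨fun n => (x n).1.1, fun n => q n (x n), fun n => (x n).1.2, fun n => (x n).2.1,
    fun n => hq n (x n), fun n => (x n).2.2⟩

lemma eq_zero_of_alphaLocalizing {W : C} (hW : A.alphaLocalizing β W)
    (h : ∀ (i : ℤ) (X : C), A.shiftBy i X → ∀ f : X ⟶ W, f = 0) : IsZero W := by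
  have : A.alphaLocalizing β ≤ leftOrthogonal (fun Y => Y = W) := by
    refine alphaClosure_le (leftOrthogonal_isExtensionClosed _)
      (leftOrthogonal_isAlphaSmashing _ _) ?_
    rintro X ⟨i, -, hX⟩ _ f rfl
    exact h i X hX f
  exact (IsZero.iff_id_eq_zero W).mpr (this W hW (𝟙 W) rfl)

section Telescope

variable {M : ℕ → C} (q : ∀ n, M n ⟶ M (n + 1)) {Z : C} {ι : ∀ n, M n ⟶ Z}
  (hc : IsColimit (Cofan.mk Z ι))

/-- The endomorphism of a coproduct of a sequence of objects induced by the transition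
morphisms. -/
noncomputable def telescopeShift : Z ⟶ Z := Cofan.IsColimit.desc hc fun n => q n ≫ ι (n + 1)

lemma ι_telescopeShift (n : ℕ) : ι n ≫ telescopeShift q hc = q n ≫ ι (n + 1) :=
  Cofan.IsColimit.fac hc _ n

/-- Postcomposition with an endomorphism. -/
def postcompEnd (X : C) {Z : C} (σ : Z ⟶ Z) : AddMonoid.End (X ⟶ Z) :=
  Preadditive.rightComp X σ

/-- The `n`-th power of the shift carries summand `m` into summand `m + n`. No compactness of `X` is
needed, because the factorization comes from the coproduct. -/
lemma exists_factor_pow_telescopeShift [HasColimitsOfShape (Discrete ℕ) C] {X : C} (f : X ⟶ Z)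
    (n : ℕ) :
    ∃ a : X ⟶ ∐ fun m => M (m + n),
      (postcompEnd X (telescopeShift q hc) ^ n) f =
        a ≫ Limits.Sigma.desc fun m => ι (m + n) := by
  induction n with
  | zero =>
    refine ⟨f ≫ Cofan.IsColimit.desc hc fun n => Limits.Sigma.ι (fun m => M (m + 0)) n, ?_⟩
    have : (Cofan.IsColimit.desc hc fun n => Limits.Sigma.ι (fun m => M (m + 0)) n) ≫
        Limits.Sigma.desc (fun m => ι (m + 0)) = 𝟙 Z :=
      Cofan.IsColimit.hom_ext hc _ _ fun n => by
        rw [Cofan.IsColimit.fac_assoc]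
        simp
    rw [Category.assoc, this, Category.comp_id]
    rfl
  | succ n ih =>
    obtain ⟨a, ha⟩ := ih
    refine ⟨a ≫ Limits.Sigma.desc fun m =>
      q (m + n) ≫ Limits.Sigma.ι (fun m => M (m + (n + 1))) m, ?_⟩
    have : Limits.Sigma.desc (fun m => ι (m + n)) ≫ telescopeShift q hc =
        (Limits.Sigma.desc fun m => q (m + n) ≫ Limits.Sigma.ι (fun m => M (m + (n + 1))) m) ≫
          Limits.Sigma.desc fun m => ι (m + (n + 1)) := by
      refine Limits.Sigma.hom_ext _ _ fun m => ?_
      rw [Limits.Sigma.ι_desc_assoc, Limits.Sigma.ι_desc_assoc, ι_telescopeShift, Category.assoc,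
        Limits.Sigma.ι_desc]
      rfl
    rw [pow_succ', Category.assoc, ← this, ← Category.assoc, ← ha]
    rfl

/-- Once `i < k + n`, the coproduct of the `M (m + n)` receives no nonzero maps from `A[i]`, so the
shift acts nilpotently. -/
lemma IsAlphaNegative.isUnit_one_sub_telescopeShift (hC : HasCoproductsLT β C)
    (hβ : Cardinal.aleph0 < β)
    (hA : A.IsAlphaNegative β) {k : ℤ}
    (hM : ∀ n : ℕ, (A.shiftsIn (Set.Ici (k + n))).alphaClosure β (M n)) {i : ℤ} {X : C}
    (hX : A.shiftBy i X) :
    IsUnit (1 - postcompEnd X (telescopeShift q hc)) := by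
  have := hC.nat hβ
  obtain ⟨n, hn⟩ : ∃ n : ℕ, i < k + n := ⟨(i + 1 - k).toNat, by omega⟩
  refine IsNilpotent.isUnit_one_sub ⟨n, ?_⟩
  ext f
  obtain ⟨a, ha⟩ := exists_factor_pow_telescopeShift q hc f n
  rw [ha, eq_zero_of_shiftBy hA (S := Set.Ici (k + n)) (fun s hs => lt_of_lt_of_le hn hs) hX
    ((alphaClosure_isAlphaSmashing _ _).of_isColimit_nat hβ (fun m => ?_)
      (coproductIsCoproduct _)) a]
  · simp
  · exact alphaClosure_mono _ (shiftsIn_mono le_rfl (by intro x; simp; omega)) _ (hM (m + n))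

/-- The map is bijective on maps from all `A[i]`, so its cone receives none of them; the cone lies
in the subcategory they generate and is therefore zero. -/
lemma IsAlphaNegative.isIso_id_sub_telescopeShift (hC : HasCoproductsLT β C)
    (hβ : Cardinal.aleph0 < β)
    (hA : A.IsAlphaNegative β) {k : ℤ}
    (hM : ∀ n : ℕ, (A.shiftsIn (Set.Ici (k + n))).alphaClosure β (M n)) :
    IsIso (𝟙 Z - telescopeShift q hc) := by
  have hZ : A.alphaLocalizing β Z :=
    (alphaClosure_isAlphaSmashing _ _).of_isColimit_nat hβ
      (fun n => alphaClosure_mono _ (shiftsIn_mono le_rfl (Set.subset_univ _)) _ (hM n)) hc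
  obtain ⟨W, b, c, hT⟩ := distinguished_cocone_triangle (𝟙 Z - telescopeShift q hc)
  have hcomp {X : C} (f : X ⟶ Z) : f ≫ (𝟙 Z - telescopeShift q hc) =
      (1 - postcompEnd X (telescopeShift q hc)) f := by
    rw [Preadditive.comp_sub, Category.comp_id]
    rfl
  have hinj {i : ℤ} {X : C} (hX : A.shiftBy i X) (f : X ⟶ Z)
      (hf : f ≫ (𝟙 Z - telescopeShift q hc) = 0) : f = 0 := by
    obtain ⟨u, hu⟩ := hA.isUnit_one_sub_telescopeShift q hc hC hβ hM hX
    rw [hcomp, ← hu] at hf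
    have h₀ : (u⁻¹.1 * u.1) f = 0 := (congr_arg u⁻¹.1 hf).trans (map_zero _)
    rwa [← Units.val_mul, inv_mul_cancel] at h₀
  have hsurj {i : ℤ} {X : C} (hX : A.shiftBy i X) (f : X ⟶ Z) :
      ∃ g, f = g ≫ (𝟙 Z - telescopeShift q hc) := by
    obtain ⟨u, hu⟩ := hA.isUnit_one_sub_telescopeShift q hc hC hβ hM hX
    have h₀ : (u.1 * u⁻¹.1) f = f := by
      rw [← Units.val_mul, mul_inv_cancel]
      rfl
    refine ⟨u⁻¹.1 f, ?_⟩
    rw [hcomp, ← hu]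
    exact h₀.symm
  have hW : IsZero W := by
    refine eq_zero_of_alphaLocalizing (A := A) (β := β)
      ((alphaClosure_isExtensionClosed _ _).ext _ (rot_of_distTriang _ hT) hZ
        (alphaClosure_shift (by simp) hZ)) fun i X hX f => ?_
    -- Desuspending turns `f ≫ c` into a map `X[-1] ⟶ Z` killed by `1 - shift`, so injectivity
    -- applies in degree `i - 1`.
    have hfc : f ≫ c = 0 := by
      let e := (shiftFunctorCompIsoId C (-1 : ℤ) 1 (by simp)).app X
      obtain ⟨g, hg⟩ := (shiftFunctor C (1 : ℤ)).map_surjective (e.hom ≫ f ≫ c)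
      have hg₀ : g = 0 := by
        refine hinj (shiftBy_shift rfl hX) g ((shiftFunctor C (1 : ℤ)).map_injective ?_)
        rw [Functor.map_comp, hg, Functor.map_zero, Category.assoc, Category.assoc]
        have : c ≫ (𝟙 Z - telescopeShift q hc)⟦(1 : ℤ)⟧' = 0 := comp_distTriang_mor_zero₃₁ _ hT
        rw [this, comp_zero, comp_zero]
      rw [hg₀, Functor.map_zero] at hg
      rwa [eq_comm, Preadditive.IsIso.comp_left_eq_zero] at hg
    obtain ⟨g, hg⟩ : ∃ g, f = g ≫ b := Triangle.coyoneda_exact₃ _ hT f hfc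
    obtain ⟨g', rfl⟩ := hsurj hX g
    have : (𝟙 Z - telescopeShift q hc) ≫ b = 0 := comp_distTriang_mor_zero₁₂ _ hT
    rw [hg, Category.assoc, this, comp_zero]
  exact (Triangle.isZero₃_iff_isIso₁ _ hT).mp hW

/-- The telescope of a constant sequence. -/
lemma distinguished_constant_telescope {N Y : C} {j : ℕ → (N ⟶ Y)}
    (hY : IsColimit (Cofan.mk (f := fun _ : ℕ => N) Y j)) :
    Triangle.mk (𝟙 Y - telescopeShift (fun _ => 𝟙 N) hY)
      (Cofan.IsColimit.desc hY fun _ => 𝟙 N) (0 : N ⟶ Y⟦(1 : ℤ)⟧) ∈ distTriang C := by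
  -- Negative partial sums telescope against `1 - shift`, leaving the copy `0` as complement.
  let r : Y ⟶ Y := Cofan.IsColimit.desc hY fun n => -∑ m ∈ Finset.range n, j m
  have hr (n) : j n ≫ r = -∑ m ∈ Finset.range n, j m := Cofan.IsColimit.fac hY _ n
  let g : Y ⟶ N := Cofan.IsColimit.desc hY fun _ => 𝟙 N
  have hg (n) : j n ≫ g = 𝟙 N := Cofan.IsColimit.fac hY _ n
  have hσ (n) : j n ≫ telescopeShift (fun _ => 𝟙 N) hY = j (n + 1) :=
    (ι_telescopeShift _ hY n).trans (Category.id_comp _)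
  refine distinguished_of_split (s := j 0) (r := r) ?_ (hg 0) ?_
  · refine Cofan.IsColimit.hom_ext hY _ _ fun n => ?_
    change j n ≫ _ ≫ r = j n ≫ 𝟙 Y
    rw [Preadditive.sub_comp, Preadditive.comp_sub, Category.id_comp, reassoc_of% hσ, hr, hr,
      Finset.sum_range_succ, Category.comp_id]
    abel
  · refine Cofan.IsColimit.hom_ext hY _ _ fun n => ?_
    change j n ≫ (r ≫ _ + g ≫ j 0) = j n ≫ 𝟙 Y
    have hsum : (∑ m ∈ Finset.range n, j m) ≫ telescopeShift (fun _ => 𝟙 N) hY =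
        ∑ m ∈ Finset.range n, j (m + 1) := by
      rw [Preadditive.sum_comp]
      exact Finset.sum_congr rfl fun m _ => hσ m
    rw [Preadditive.comp_add, reassoc_of% hr, reassoc_of% hg, Preadditive.neg_comp,
      Preadditive.comp_sub, Category.comp_id, hsum, Category.comp_id, ← Finset.sum_sub_distrib,
      Finset.sum_range_sub']
    abel

end Telescope

/-- Objects generated by the `A[i]`, `i ≥ k`, are homotopy colimits of objects with finitely many
cells. -/
lemma IsAlphaNegative.alphaClosure_le_countableCells [IsTriangulated C]
    (hC : HasCoproductsLT β C) (hβ : β.IsRegular) (hβ' : Cardinal.aleph0 < β)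
    (hA : A.IsAlphaNegative β) (hA' : A.IsAlphaSmashing β) (k : ℤ) :
    (A.shiftsIn (Set.Ici k)).alphaClosure β ≤
      extensionProduct (A.countableCells k) ((A.countableCells k).shiftBy 1) := by
  intro N hN
  have := hC.nat hβ'
  have := hA'.isClosedUnderIsomorphisms (Cardinal.one_lt_aleph0.trans_le hβ.1)
  have := (countableCells_isAlphaSmashing hC hA' k).isClosedUnderIsomorphisms
    (Cardinal.one_lt_aleph0.trans_le hβ.1)
  obtain ⟨M, q, p, hM, hpq, hF⟩ := hA.exists_tower hC hβ hA' k hN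
  choose F f h hT hF using hF
  have hY := coproductIsCoproduct (fun _ : ℕ => N)
  -- Only the quotient maps `N ⟶ M n` have to be compatible; no transition maps between the `F n`
  -- are chosen.
  obtain ⟨Z, f', g', h', ι, hT', hι, ⟨hc⟩⟩ :=
    exists_distinguished_of_isColimit_cofan hT (coproductIsCoproduct F) hY
  have := hA.isIso_id_sub_telescopeShift q hc hC hβ' hM
  have hcomm : (𝟙 _ - telescopeShift (fun _ => 𝟙 N) hY) ≫ g' =
      g' ≫ (𝟙 Z - telescopeShift q hc) := by
    refine Limits.Sigma.hom_ext _ _ fun n => ?_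
    have hσ := ι_telescopeShift (fun _ => 𝟙 N) hY n
    rw [Category.id_comp] at hσ
    simp only [Preadditive.sub_comp, Preadditive.comp_sub, Category.id_comp, Category.comp_id]
    rw [reassoc_of% hσ, ← hι, ← hι, ← reassoc_of% hι, ι_telescopeShift, ← reassoc_of% hpq]
  -- Composing `g'` with an isomorphism leaves its cone `(∐ F)[1]` unchanged.
  have hT'' : Triangle.mk (g' ≫ (𝟙 Z - telescopeShift q hc))
      (inv (𝟙 Z - telescopeShift q hc) ≫ h') (-f'⟦(1 : ℤ)⟧') ∈ distTriang C := by
    refine isomorphic_distinguished _ (rot_of_distTriang _ hT') _ (Triangle.isoMk _ _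
      (Iso.refl _) (asIso (𝟙 Z - telescopeShift q hc)).symm (Iso.refl _) ?_ ?_ ?_)
    · change (g' ≫ (𝟙 Z - telescopeShift q hc)) ≫ inv (𝟙 Z - telescopeShift q hc) = 𝟙 _ ≫ g'
      rw [Category.assoc, IsIso.hom_inv_id, Category.comp_id, Category.id_comp]
    · exact Category.comp_id _
    · change (-f'⟦(1 : ℤ)⟧') ≫ (𝟙 _)⟦(1 : ℤ)⟧' = 𝟙 _ ≫ (-f'⟦(1 : ℤ)⟧')
      rw [Functor.map_id, Category.comp_id, Category.id_comp]
  -- The cones of the two factors are `N` and `(∐ F)[1]`, and that of the composite is again `(∐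
  -- F)[1]`; the resulting triangle, rotated back, exhibits `N` as the extension.
  let o := Triangulated.someOctahedron hcomm (distinguished_constant_telescope hY)
    (rot_of_distTriang _ hT') hT''
  have hB : A.countableCells k (∐ F) := ⟨F, _, hF, ⟨coproductIsCoproduct F⟩⟩
  exact ⟨_, _, _, _, _, inv_rot_of_distTriang _ o.mem,
    (shiftBy_iff (by simp) _).mp (shiftBy_obj 1 hB), shiftBy_obj 1 hB⟩

/-- The closure equals the extension product of two classes that inherit closure under `α`-small
coproducts from `A`. -/
lemma IsAlphaNegative.alphaClosure_isAlphaSmashing_of_le [IsTriangulated C]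
    (hC : HasCoproductsLT α C) (hβα : β ≤ α) (hβ : β.IsRegular) (hβ' : Cardinal.aleph0 < β)
    (hA : A.IsAlphaNegative β) (hA' : A.IsAlphaSmashing α) (k : ℤ) :
    ((A.shiftsIn (Set.Ici k)).alphaClosure β).IsAlphaSmashing α := by
  have h₁ : 1 < α := (Cardinal.one_lt_aleph0.trans_le hβ.1).trans_le hβα
  have := hA'.isClosedUnderIsomorphisms h₁
  have hs := countableCells_isAlphaSmashing hC hA' k
  have := hs.isClosedUnderIsomorphisms h₁
  have heq : (A.shiftsIn (Set.Ici k)).alphaClosure β =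
      extensionProduct (A.countableCells k) ((A.countableCells k).shiftBy 1) := by
    refine le_antisymm (hA.alphaClosure_le_countableCells (hC.mono hβα) hβ hβ' (hA'.mono hβα) k)
      ((alphaClosure_isExtensionClosed _ _).extensionProduct_le
        (countableCells_le_alphaClosure A hβ' k) ?_)
    rintro X ⟨Y, hY, ⟨e⟩⟩
    exact prop_of_iso _ e.symm (alphaClosure_shift (by simp; omega)
      (countableCells_le_alphaClosure A hβ' k _ hY))
  rw [heq]
  exact extensionProduct_isAlphaSmashing hC hs (shiftBy_isAlphaSmashing hs 1)

lemma isAlphaNegative_iff_coproductsLT [IsTriangulated C] {P : ObjectProperty C}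
    (hC : HasCoproductsLT α C) (hα : α.IsRegular) (hβα : β ≤ α) (hβ : β.IsRegular)
    (hβ' : Cardinal.aleph0 < β) :
    P.IsAlphaNegative α ↔ (P.coproductsLT α).IsAlphaNegative β := by
  have h₁ : 1 < α := (Cardinal.one_lt_aleph0.trans_le hβ.1).trans_le hβα
  constructor
  · intro hP X Y hX hY f
    refine hP.coproductsLT X Y hX ?_ f
    refine alphaClosure_le (alphaClosure_isExtensionClosed _ _)
      ((alphaClosure_isAlphaSmashing _ _).mono hβα) ?_ _ hY
    rintro Y ⟨i, hi, Z, hZ, ⟨e⟩⟩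
    refine prop_of_iso _ e.symm (alphaClosure_shift (S := {0}) (by simpa using hi)
      (coproductsLT_le_alphaClosure P α (by simp) _ hZ))
  · intro hP X Y hX hY f
    refine hP X Y (le_coproductsLT P h₁ _ hX) ?_ f
    -- Positive integers are those `≥ 1`, whence `k = 1`.
    exact alphaClosure_le (alphaClosure_isExtensionClosed _ _)
      (hP.alphaClosure_isAlphaSmashing_of_le hC hβα hβ hβ' (coproductsLT_isAlphaSmashing P hα) 1)
      ((shiftsIn_mono (le_coproductsLT P h₁) le_rfl).trans (le_alphaClosure _ _)) _ hY

end CategoryTheory.ObjectProperty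

end Triangulated

/-! ### Passage to the `α`-localizing subcategory. -/

section Smashing

variable {C : Type u} [Category.{v} C]

namespace CategoryTheory.ObjectProperty

variable {T : ObjectProperty C} {α : Cardinal.{w}}

lemma IsAlphaSmashing.isClosedUnderColimitsOfShape (hT : T.IsAlphaSmashing α) {J : Type w}
    (hJ : Cardinal.mk J < α) : T.IsClosedUnderColimitsOfShape (Discrete J) where
  colimitsOfShape_le := by
    rintro X ⟨h⟩
    refine hT _ ⟨J, hJ, fun j => h.diag.obj ⟨j⟩, fun j => h.ι.app ⟨j⟩,
      fun j => h.prop_diag_obj ⟨j⟩,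
      ⟨Cofan.IsColimit.mk _ (fun s => h.isColimit.desc
        (Cocone.mk s.pt (Discrete.natTrans fun j => s.inj j.as))) ?_ ?_⟩⟩
    · exact fun s j => h.isColimit.fac _ ⟨j⟩
    · intro s m hm
      exact h.isColimit.hom_ext fun j => (hm j.as).trans (h.isColimit.fac
        (Cocone.mk s.pt (Discrete.natTrans fun j => s.inj j.as)) j).symm

lemma IsAlphaSmashing.hasCoproductsLT_fullSubcategory (hT : T.IsAlphaSmashing α)
    (hC : HasCoproductsLT α C) : HasCoproductsLT α T.FullSubcategory := by
  intro J hJ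
  have := hT.isClosedUnderColimitsOfShape hJ
  have := hC J hJ
  infer_instance

lemma IsAlphaSmashing.preservesCoproductsLT_ι (hT : T.IsAlphaSmashing α)
    (hC : HasCoproductsLT α C) : PreservesCoproductsLT α T.ι := by
  intro J hJ
  have := hT.isClosedUnderColimitsOfShape hJ
  have := hC J hJ
  infer_instance

lemma coproductsLT_inverseImage_ι (hT : T.IsAlphaSmashing α) (hC : HasCoproductsLT α C)
    {R : ObjectProperty C} (hR : R ≤ T) :
    (R.inverseImage T.ι).coproductsLT α = (R.coproductsLT α).inverseImage T.ι := by
  refine le_antisymm ?_ ?_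
  · rintro Y ⟨J, hJ, X, ι, hX, ⟨hc⟩⟩
    have := hT.preservesCoproductsLT_ι hC J hJ
    exact ⟨J, hJ, _, _, hX, ⟨isColimitCofanMkObjOfIsColimit T.ι _ _ hc⟩⟩
  · rintro Y ⟨J, hJ, X, ι, hX, ⟨hc⟩⟩
    exact ⟨J, hJ, fun j => ⟨X j, hR _ (hX j)⟩, fun j => T.fullyFaithfulι.preimage (ι j), hX,
      ⟨isColimitOfIsColimitCofanMkObj T.ι _ _ hc⟩⟩

end CategoryTheory.ObjectProperty

end Smashing

section Triangulated

open scoped ZeroObject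

variable {C : Type u} [Category.{v} C] [HasZeroObject C] [Preadditive C] [HasShift C ℤ]
  [∀ n : ℤ, (shiftFunctor C n).Additive] [Pretriangulated C]

namespace CategoryTheory.ObjectProperty

variable {T P R : ObjectProperty C} [T.IsTriangulated] {α : Cardinal.{w}}

/-- Generating inside a triangulated subcategory closed under small coproducts is the same as
generating in the ambient category. -/
lemma alphaClosure_inverseImage_ι [T.IsClosedUnderIsomorphisms] (hC : HasCoproductsLT α C)
    (hT : T.IsAlphaSmashing α) (hR : R ≤ T) :
    (R.inverseImage T.ι).alphaClosure α = (R.alphaClosure α).inverseImage T.ι := by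
  refine le_antisymm ?_ ?_
  · intro X hX
    exact obj_of_alphaClosure T.ι (hT.preservesCoproductsLT_ι hC)
      (alphaClosure_isExtensionClosed _ _) (alphaClosure_isAlphaSmashing _ _)
      (fun X hX => le_alphaClosure _ _ _ hX) hX
  · intro X hX
    -- The predicate carries membership in `T`, without which the object of the subcategory cannot
    -- be formed.
    have key : R.alphaClosure α ≤
        fun X => ∃ h : T X, (R.inverseImage T.ι).alphaClosure α ⟨X, h⟩ := by
      refine alphaClosure_le ⟨fun Z hZ => ?_, fun U hU => ?_⟩ ?_
        fun Y hY => ⟨hR _ hY, le_alphaClosure _ _ _ hY⟩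
      · exact ⟨T.prop_of_isZero hZ, (alphaClosure_isExtensionClosed _ _).zero _
          ((IsZero.iff_id_eq_zero _).mpr (T.ι.map_injective (hZ.eq_of_src _ _)))⟩
      · rintro ⟨h₁, h₁'⟩ ⟨h₃, h₃'⟩
        have h₂ : T U.obj₂ := T.ext_of_isTriangulatedClosed₂ _ hU h₁ h₃
        let X₁ : T.FullSubcategory := ⟨U.obj₁, h₁⟩
        let X₂ : T.FullSubcategory := ⟨U.obj₂, h₂⟩
        let X₃ : T.FullSubcategory := ⟨U.obj₃, h₃⟩
        let f : X₁ ⟶ X₂ := T.fullyFaithfulι.preimage U.mor₁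
        let g : X₂ ⟶ X₃ := T.fullyFaithfulι.preimage U.mor₂
        let h₀ : T.ι.obj X₃ ⟶ (T.ι.obj X₁)⟦(1 : ℤ)⟧ := U.mor₃
        -- The shift of the subcategory matches the ambient one only through `commShiftIso`, which
        -- corrects the third map before it is lifted.
        let h : X₃ ⟶ X₁⟦(1 : ℤ)⟧ :=
          T.fullyFaithfulι.preimage (h₀ ≫ (T.ι.commShiftIso (1 : ℤ)).inv.app X₁)
        have hh : T.ι.map h ≫ (T.ι.commShiftIso (1 : ℤ)).hom.app X₁ = h₀ := by
          rw [T.fullyFaithfulι.map_preimage, Category.assoc, Iso.inv_hom_id_app]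
          exact Category.comp_id _
        have hU' : Triangle.mk f g h ∈ distTriang T.FullSubcategory := by
          rw [← T.ι.map_distinguished_iff]
          refine isomorphic_distinguished _ hU _ (Triangle.isoMk _ _ (Iso.refl _) (Iso.refl _)
            (Iso.refl _) ?_ ?_ ?_)
          · exact (Category.comp_id _).trans (Category.id_comp _).symm
          · exact (Category.comp_id _).trans (Category.id_comp _).symm
          · refine (congr_arg₂ (· ≫ ·) hh (Functor.map_id _ _)).trans ?_
            exact (Category.comp_id _).trans (Category.id_comp _).symm
        exact ⟨h₂, (alphaClosure_isExtensionClosed _ _).ext _ hU' h₁' h₃'⟩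
      · rintro Y ⟨J, hJ, X, ι, hX, ⟨hc⟩⟩
        have hX' (j) : T (X j) := (hX j).1
        have hY : T Y := hT _ ⟨J, hJ, X, ι, hX', ⟨hc⟩⟩
        let X' (j : J) : T.FullSubcategory := ⟨X j, hX' j⟩
        let Y' : T.FullSubcategory := ⟨Y, hY⟩
        let ι' (j : J) : X' j ⟶ Y' := T.fullyFaithfulι.preimage (ι j)
        exact ⟨hY, alphaClosure_isAlphaSmashing _ _ _ ⟨J, hJ, X', ι', fun j => (hX j).2,
          ⟨isColimitOfIsColimitCofanMkObj T.ι _ _ hc⟩⟩⟩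
    exact (key _ hX).2

lemma shiftsIn_inverseImage_ι (hP : P ≤ T) (S : Set ℤ) :
    (P.inverseImage T.ι).shiftsIn S = (P.shiftsIn S).inverseImage T.ι := by
  refine le_antisymm (fun X hX => shiftsIn_obj_of_commShift T.ι (fun _ hX => hX) hX) ?_
  rintro X ⟨i, hi, M, hM, ⟨e⟩⟩
  exact ⟨i, hi, ⟨M, hP _ hM⟩, hM, ⟨T.fullyFaithfulι.preimageIso
    (e ≪≫ ((T.ι.commShiftIso i).app ⟨M, hP _ hM⟩).symm)⟩⟩

section Localizing

variable (P α)

instance : (P.alphaLocalizing α).IsClosedUnderIsomorphisms :=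
  inferInstanceAs ((P.shiftsIn Set.univ).alphaClosure α).IsClosedUnderIsomorphisms

lemma le_alphaLocalizing : P ≤ P.alphaLocalizing α :=
  (le_shiftsIn P (Set.mem_univ _)).trans (le_alphaClosure _ _)

lemma alphaLocalizing_isAlphaSmashing : (P.alphaLocalizing α).IsAlphaSmashing α :=
  alphaClosure_isAlphaSmashing _ _

variable {P α} in
lemma alphaLocalizing_isStableUnderRetracts (hC : HasCoproductsLT α C)
    (hα : Cardinal.aleph0 < α) : (P.alphaLocalizing α).IsStableUnderRetracts :=
  isStableUnderRetracts_of_shift_one hC hα (alphaClosure_isExtensionClosed _ _)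
    (alphaClosure_isAlphaSmashing _ _) fun _ hX => alphaClosure_shift (by simp) hX

lemma alphaClosure_shiftsIn_inverseImage_ι (hC : HasCoproductsLT α C) (S : Set ℤ) :
    ((P.inverseImage (P.alphaLocalizing α).ι).shiftsIn S).alphaClosure α =
      ((P.shiftsIn S).alphaClosure α).inverseImage (P.alphaLocalizing α).ι := by
  rw [shiftsIn_inverseImage_ι (P.le_alphaLocalizing α)]
  exact alphaClosure_inverseImage_ι hC (P.alphaLocalizing_isAlphaSmashing α)
    ((shiftsIn_mono le_rfl (Set.subset_univ _)).trans (le_alphaClosure _ _))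

variable {P α}

lemma IsAlphaNegative.inverseImage_ι (hC : HasCoproductsLT α C) (hP : P.IsAlphaNegative α) :
    (P.inverseImage (P.alphaLocalizing α).ι).IsAlphaNegative α := by
  intro X Y hX hY f
  rw [alphaClosure_shiftsIn_inverseImage_ι P α hC] at hY
  exact (P.alphaLocalizing α).ι.map_injective
    ((hP _ _ hX hY _).trans (Functor.map_zero _ _ _).symm)

lemma alphaLocalizing_inverseImage_ι (hC : HasCoproductsLT α C)
    (X : (P.alphaLocalizing α).FullSubcategory) :
    (P.inverseImage (P.alphaLocalizing α).ι).alphaLocalizing α X :=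
  (congr_fun (alphaClosure_shiftsIn_inverseImage_ι P α hC Set.univ) X).mpr X.property

/-- Retracts formed in `C` do not leave the subcategory, which is retract-closed by the swindle. -/
lemma map_ι_retractClosure_coproductsLT (hC : HasCoproductsLT α C)
    (hα : Cardinal.aleph0 < α) :
    ((P.inverseImage (P.alphaLocalizing α).ι).coproductsLT α).retractClosure.map
      (P.alphaLocalizing α).ι = (P.coproductsLT α).retractClosure := by
  have hs := P.alphaLocalizing_isAlphaSmashing α
  have := alphaLocalizing_isStableUnderRetracts (P := P) hC hα
  rw [coproductsLT_inverseImage_ι hs hC (P.le_alphaLocalizing α)]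
  refine le_antisymm ?_ ?_
  · rintro X ⟨X', ⟨Y, hY, ⟨ρ⟩⟩, ⟨e⟩⟩
    exact ⟨_, hY, ⟨(Retract.ofIso e.symm).trans (ρ.map (P.alphaLocalizing α).ι)⟩⟩
  · rintro X ⟨Y, hY, ⟨ρ⟩⟩
    have hYT : P.alphaLocalizing α Y :=
      hs _ (coproductsLT_mono (P.le_alphaLocalizing α) le_rfl _ hY)
    have hXT : P.alphaLocalizing α X := prop_of_retract _ ρ hYT
    exact ⟨⟨X, hXT⟩, ⟨⟨Y, hYT⟩, hY, ⟨⟨(P.alphaLocalizing α).fullyFaithfulι.preimage ρ.i,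
      (P.alphaLocalizing α).fullyFaithfulι.preimage ρ.r,
      (P.alphaLocalizing α).ι.map_injective ρ.retract⟩⟩⟩, ⟨Iso.refl _⟩⟩

end Localizing

end CategoryTheory.ObjectProperty

end Triangulated

theorem theorem2p2p1 (α : Cardinal.{w}) (hα : α.IsRegular)
    {C : Type u} [Category.{v} C] [HasZeroObject C] [Preadditive C] [HasShift C ℤ]
    [∀ n : ℤ, (shiftFunctor C n).Additive] [Pretriangulated C] [IsTriangulated C]
    (hC : HasCoproductsLT α C) (P : ObjectProperty C) :
    -- existence on the `α`-localizing subcategory generated by an `α`-negative class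
    (Cardinal.aleph0 < α → P.IsAlphaNegative α →
      ∃ t : WeightStructure (P.alphaLocalizing α).FullSubcategory,
        t.IsAlphaSmashing α ∧ t.IsAlphaGeneratedBy α (P.inverseImage (P.alphaLocalizing α).ι)) ∧
    -- converse, left non-degeneracy, generation, and the heart
    (∀ t : WeightStructure C, t.IsAlphaGeneratedBy α P →
      P.IsAlphaNegative α ∧ t.IsLeftNonDegenerate ∧ t.IsGeneratedBy P ∧
      t.heart = (P.coproductsLT α).retractClosure) ∧
    -- for uncountable `α` the heart on the subcategory may be computed with retracts in `C`
    (Cardinal.aleph0 < α →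
      (P.alphaLocalizing α).IsStableUnderRetracts ∧
      ∀ t : WeightStructure (P.alphaLocalizing α).FullSubcategory,
        t.IsAlphaGeneratedBy α (P.inverseImage (P.alphaLocalizing α).ι) →
        t.heart.map (P.alphaLocalizing α).ι = (P.coproductsLT α).retractClosure) ∧
    -- weight-exactness criteria and `α`-generation of the target weight structure
    (∀ t : WeightStructure C, t.IsAlphaGeneratedBy α P →
      ∀ {D : Type u'} [Category.{v'} D] [HasZeroObject D] [Preadditive D] [HasShift D ℤ]
        [∀ n : ℤ, (shiftFunctor D n).Additive] [Pretriangulated D] [IsTriangulated D]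
        (s : WeightStructure D) (F : C ⥤ D) [F.CommShift ℤ] [F.IsTriangulated],
        PreservesCoproductsLT α F →
        (t.IsLeftWeightExact s F ↔ ∀ X : C, P X → s.le (F.obj X)) ∧
        (s.IsAlphaSmashing α →
          (t.IsRightWeightExact s F ↔ ∀ X : C, P X → s.ge (F.obj X))) ∧
        (Cardinal.aleph0 < α → F.EssSurj → t.IsLeftWeightExact s F → t.IsRightWeightExact s F →
          s.IsAlphaGeneratedBy α (P.map F))) ∧
    -- uniqueness
    (Cardinal.aleph0 < α → ∀ t : WeightStructure C, t.IsAlphaGeneratedBy α P →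
      ∀ s : WeightStructure C, (s.IsAlphaSmashing α ∧ P ≤ s.heart) ↔ s = t) ∧
    -- reduction of `α`-negativity to countable negativity
    (Cardinal.aleph 1 ≤ α →
      (P.IsAlphaNegative α ↔ (P.coproductsLT α).IsAlphaNegative (Cardinal.aleph.{w} 1))) := by
  refine ⟨fun hα₀ hP => ?_, fun t ht => ?_, fun hα₀ => ⟨?_, fun t ht => ?_⟩,
    fun t ht D _ _ _ _ _ _ _ s F _ _ hF => ?_, fun _ t ht s => ht.eq_iff s, fun hα₁ => ?_⟩
  · have hQ := hP.inverseImage_ι hC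
    have hC' := (P.alphaLocalizing_isAlphaSmashing α).hasCoproductsLT_fullSubcategory hC
    have ht := hQ.isAlphaGeneratedBy_weightStructure hC' hα₀
      (ObjectProperty.alphaLocalizing_inverseImage_ι hC)
    exact ⟨_, ht.isAlphaSmashing, ht⟩
  · exact ⟨ht.isAlphaNegative, ht.isLeftNonDegenerate, ht.isGeneratedBy, ht.heart_eq hα⟩
  · exact ObjectProperty.alphaLocalizing_isStableUnderRetracts hC hα₀
  · rw [ht.heart_eq hα, ObjectProperty.map_ι_retractClosure_coproductsLT hC hα₀]
  · exact ⟨ht.isLeftWeightExact_iff hF, fun hs => ht.isRightWeightExact_iff hF hs,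
      fun hα₀ _ hl hr => ht.isAlphaGeneratedBy_map_of_essSurj hF hα₀ hl hr⟩
  · exact ObjectProperty.isAlphaNegative_iff_coproductsLT hC hα hα₁ Cardinal.isRegular_aleph_one
      (Cardinal.aleph0_lt_aleph_one)
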